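/- **Theorem.** Let $m\in\mathbb N$ and let $\pi_1,\dots,\pi_m$ be probability densities on $\mathbb R$ that are continuous, everywhere positive and symmetric around $0$. For $\vec\theta\in\Theta=\{\vec\theta\in\mathbb R^m:\theta_m=0\}$ the symmetric random utility model (RUM) with shapes $\pi_1,\dots,\pi_m$ draws independent utilities $u_1,\dots,u_m$, where $u_i$ has density $x\mapsto\pi_i(x-\theta_i)$, and ranks the alternatives $a_1,\dots,a_m$ by descending utility; a profile $P=(R_1,\dots,R_n)$ consists of $n$ independent rankings drawn in this way. Let $p_{ij}(\vec\theta)=\Pr(u_i>u_j\mid\vec\theta)$. Let $\mathcal G=\{g_{kl}\}$ be a weighted breaking, i.e. nonnegative weights $g_{kl}=g_{lk}$ on the pairs of distinct positions in $\{1,\dots,m\}$, not all zero. It is *uniform* if all the weights $g_{kl}$ ($k\neq l$) are equal. For a profile $P$ of $n$ rankings, let $\kappa_{ij}(P)$ be $\frac1n$ times the sum, over those rankings $R_t$ that rank $a_i$ above $a_j$, of $g_{kl}$, where $k$ and $l$ are the positions of $a_i$ and $a_j$ in $R_t$. Let $\mathcal W_{\mathrm u}$ be a uniform CML-weight vector: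 $w_{ij}=w>0$ for all $i\ne j$. Let $\mathrm{RBCML}(\mathcal G,\mathcal W_{\mathrm u})(P)$ be the set of maximizers over $\vec\theta\in\Theta$ of the composite log-marginal likelihood $$\mathrm{CLL}(\vec\theta,P)=\sum_{i\neq j}\kappa_{ij}(P)\,w_{ij}\,\ln p_{ij}(\vec\theta).$$ It is called *consistent* if for every $\vec\theta_0\in\Theta$ and every $\varepsilon>0$, when $P$ consists of $n$ independent rankings drawn from the RUM with parameter $\vec\theta_0$, the probability that a maximizer exists and all maximizers have distance less than $\varepsilon$ from $\vec\theta_0$ tends to $1$ as $n\to\infty$. Suppose that for some $i$ the density $\pi_i$ is differentiable, $(\ln\pi_i)'$ is monotonically decreasing (not necessarily strictly), and $(\ln\pi_i)'(x)\to\infty$ as $x\to-\infty$. Then $\mathrm{RBCML}(\mathcal G,\mathcal W_{\mathrm u})$ is consistent if and only if $\mathcal G$ is uniform. -/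

import Mathlib

open MeasureTheory Filter Topology

noncomputable section

/-- A ranking (linear order) of `m` alternatives: `R k` is the alternative at position `k`, where
position `0` is the top; `R.symm i` is the position of alternative `i`. -/
abbrev Ranking (m : ℕ) := Equiv.Perm (Fin m)

/-- A preference profile of `n` rankings over `m` alternatives. -/
abbrev Profile (m n : ℕ) := Fin n → Ranking m

/-- The shape of a utility distribution: a probability density on the real line that is continuous
and positive everywhere. -/
structure IsUtilityDensity (f : ℝ → ℝ) : Prop where
  continuous : Continuous f
  pos : ∀ x, 0 < f x
  integrable : Integrable f
  integral_eq_one : ∫ x, f x = 1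

/-- The parameter space of the location family: real vectors, one entry for each alternative,
normalized so that the entry of the last alternative is `0`. -/
def paramSpace (m : ℕ) : Set (Fin m → ℝ) :=
  {θ | ∀ i : Fin m, (i : ℕ) + 1 = m → θ i = 0}

/-- The joint law of the latent utilities in the location family with shapes `π`: the utilities are
independent, and the utility of alternative `i` has density `x ↦ π i (x - θ i)`. -/
def utilityLaw {m : ℕ} (π : Fin m → ℝ → ℝ) (θ : Fin m → ℝ) : Measure (Fin m → ℝ) :=
  Measure.pi fun i => volume.withDensity fun x => ENNReal.ofReal (π i (x - θ i))

/-- The probability of the ranking `R`: the alternatives are ranked by descending utility. -/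
def rankingProb {m : ℕ} (π : Fin m → ℝ → ℝ) (θ : Fin m → ℝ) (R : Ranking m) : ℝ :=
  (utilityLaw π θ).real {u | ∀ k l : Fin m, k < l → u (R l) < u (R k)}

/-- The probability that alternative `i` is ranked above alternative `j`. -/
def pairProb {m : ℕ} (π : Fin m → ℝ → ℝ) (θ : Fin m → ℝ) (i j : Fin m) : ℝ :=
  (utilityLaw π θ).real {u | u j < u i}

/-- The probability of an event `S` for a profile of `n` rankings drawn independently from the
random utility model with parameter `θ`. -/
def profileProb {m : ℕ} (π : Fin m → ℝ → ℝ) (θ : Fin m → ℝ) (n : ℕ)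
    (S : Set (Profile m n)) : ℝ :=
  ∑ P : Profile m n, S.indicator (fun P => ∏ t, rankingProb π θ (P t)) P

/-- A weighted rank-breaking: an undirected graph on the positions with nonnegative edge weights.
Weight `0` means that there is no edge; the diagonal plays no role. -/
structure Breaking (m : ℕ) where
  weight : Fin m → Fin m → ℝ
  symm : ∀ k l, weight k l = weight l k
  nonneg : ∀ k l, 0 ≤ weight k l

/-- The breaking has at least one edge. -/
def Breaking.IsNonempty {m : ℕ} (G : Breaking m) : Prop :=
  ∃ k l, k ≠ l ∧ 0 < G.weight k l

/-- All pairs of distinct positions have the same weight. -/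
def Breaking.IsUniform {m : ℕ} (G : Breaking m) : Prop :=
  ∃ c, ∀ k l, k ≠ l → G.weight k l = c

/-- A CML-weight vector: one nonnegative weight for each ordered pair of distinct alternatives;
the diagonal plays no role. -/
structure CMLWeight (m : ℕ) where
  weight : Fin m → Fin m → ℝ
  nonneg : ∀ i j, 0 ≤ weight i j

/-- All weights have the same positive value. -/
def CMLWeight.IsUniform {m : ℕ} (W : CMLWeight m) : Prop :=
  ∃ c, 0 < c ∧ ∀ i j, i ≠ j → W.weight i j = c

/-- The weight of the comparison "`i` above `j`" that the breaking extracts from the ranking `R`: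
the weight of the edge between the two positions if `R` ranks `i` above `j`, and `0` otherwise. -/
def Breaking.extract {m : ℕ} (G : Breaking m) (R : Ranking m) (i j : Fin m) : ℝ :=
  if R.symm i < R.symm j then G.weight (R.symm i) (R.symm j) else 0

/-- The average weight of the comparison "`i` above `j`" in the profile `P`. -/
def Breaking.kappa {m n : ℕ} (G : Breaking m) (P : Profile m n) (i j : Fin m) : ℝ :=
  (∑ t, G.extract (P t) i j) / n

/-- The composite log-marginal likelihood. -/
def cll {m n : ℕ} (π : Fin m → ℝ → ℝ) (G : Breaking m) (W : CMLWeight m)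
    (P : Profile m n) (θ : Fin m → ℝ) : ℝ :=
  ∑ q ∈ (Finset.univ : Finset (Fin m)).offDiag,
    G.kappa P q.1 q.2 * W.weight q.1 q.2 * Real.log (pairProb π θ q.1 q.2)

/-- The output of rank-breaking-then-composite-marginal-likelihood on the profile `P`: the set of
all maximizers of the composite log-marginal likelihood over the parameter space. -/
def rbcml {m n : ℕ} (π : Fin m → ℝ → ℝ) (G : Breaking m) (W : CMLWeight m)
    (P : Profile m n) : Set (Fin m → ℝ) :=
  {θ | θ ∈ paramSpace m ∧ IsMaxOn (cll π G W P) (paramSpace m) θ}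

/-- Consistency: whatever the ground truth `θ₀`, with probability tending to `1` as the number of
rankings grows a maximizer exists and every maximizer is within `ε` of `θ₀`. -/
def RBCMLConsistent {m : ℕ} (π : Fin m → ℝ → ℝ) (G : Breaking m) (W : CMLWeight m) : Prop :=
  ∀ θ₀ ∈ paramSpace m, ∀ ε : ℝ, 0 < ε →
    Tendsto
      (fun n : ℕ => profileProb π θ₀ n
        {P | (rbcml π G W P).Nonempty ∧ ∀ θ ∈ rbcml π G W P, dist θ θ₀ < ε})
      atTop (𝓝 1)

end

/-! Uniform weights imply consistency by Gibbs' inequality. If every weight is `c`, the expected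
weight of "`i` above `j`" under `θ₀` is `c` times the pairwise win probability, and the expected
objective has `θ₀` as its only normalized maximizer (`compLik_lt_of_ne`). Compactness extends this
to all comparison weights near the expected ones (`eventually_argmax_compLik`), and the weak law of
large numbers puts the empirical weights there.

For the converse, consistency forces each `θ` to maximize the expected objective generated by `θ`
itself (`RBCMLConsistent.compLik_le`). Let `a` be the light-tailed alternative. Differentiating in
its location gives, for every `θ`, a vanishing sum over `j ≠ a` of a positive density times (mean
weight given that `a` beats `j`) minus (mean weight given that `j` beats `a`). The equation is
linear in the weights and holds for constant ones, so constants may be subtracted.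

Two limits extract single weights. Pushing some alternatives to `∞` and others to `-∞` leaves an
equation for a group that occupies exactly the positions `k, ..., l` and contains `a`
(`sum_level_eq_zero`). Then `a` is moved far ahead by `t` within the group. Assume that `g k x = 0`
for `k < x < l` and `k + 1 < l`. When `a` wins it sits at `k`, and the mean weight tends to `g k l`
times the positive probability that `j` is at `l`. When `a` loses to `j`, the light tail makes it
overwhelmingly likely that it loses to nobody else in the group; then `j` and `a` sit at `k` and `k
+ 1`, where the weight is zero. All terms thus get the sign of `g k l`, so `g k l = 0`. Induction on
`l` gives `g k l = g k (k + 1)` (`weight_eq_weight_succ`); reflecting the noise gives `g k l = g (l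
- 1) l`, and together these yield uniformity. -/

noncomputable section

/-! ### Independent draws from a finite distribution and the weak law of large numbers -/

/-- The probability of an event for `n` independent draws from a weight function on a finite
type. -/
def iidProb {α : Type*} [Fintype α] (p : α → ℝ) (n : ℕ) (S : Set (Fin n → α)) : ℝ :=
  ∑ P : Fin n → α, S.indicator (fun P => ∏ t, p (P t)) P

section IID

variable {α : Type*} [Fintype α] {p : α → ℝ}

theorem iidProb_mono (hp : ∀ a, 0 ≤ p a) {n : ℕ} {S T : Set (Fin n → α)} (h : S ⊆ T) :
    iidProb p n S ≤ iidProb p n T :=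
  Finset.sum_le_sum fun _ _ => Set.indicator_le_indicator_of_subset h
    (fun _ => Finset.prod_nonneg fun _ _ => hp _) _

theorem sum_prod_fin_eq_one (hs : ∑ a, p a = 1) (n : ℕ) :
    ∑ P : Fin n → α, ∏ t, p (P t) = 1 := by
  rw [← Fintype.sum_pow, hs, one_pow]

theorem iidProb_le_one (hp : ∀ a, 0 ≤ p a) (hs : ∑ a, p a = 1) {n : ℕ} (S : Set (Fin n → α)) :
    iidProb p n S ≤ 1 := by
  rw [← sum_prod_fin_eq_one hs n]
  exact Finset.sum_le_sum fun P _ =>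
    Set.indicator_le_self' (fun _ _ => Finset.prod_nonneg fun _ _ => hp _) _

theorem iidProb_add_compl (hs : ∑ a, p a = 1) {n : ℕ} (S : Set (Fin n → α)) :
    iidProb p n S + iidProb p n Sᶜ = 1 := by
  rw [← sum_prod_fin_eq_one hs n, iidProb, iidProb, ← Finset.sum_add_distrib]
  exact Finset.sum_congr rfl fun P _ => Set.indicator_self_add_compl_apply _ _ _

theorem iidProb_iUnion_le (hp : ∀ a, 0 ≤ p a) {n : ℕ} {ι : Type*} [Fintype ι]
    (S : ι → Set (Fin n → α)) :
    iidProb p n (⋃ i, S i) ≤ ∑ i, iidProb p n (S i) := by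
  simp only [iidProb]
  rw [Finset.sum_comm]
  refine Finset.sum_le_sum fun P _ => ?_
  have hnn : 0 ≤ ∏ t, p (P t) := Finset.prod_nonneg fun _ _ => hp _
  have hi : ∀ i ∈ Finset.univ, 0 ≤ (S i).indicator (fun P => ∏ t, p (P t)) P :=
    fun i _ => Set.indicator_nonneg (fun _ _ => Finset.prod_nonneg fun _ _ => hp _) _
  by_cases h : P ∈ ⋃ i, S i
  · obtain ⟨i, h'⟩ := Set.mem_iUnion.1 h
    rw [Set.indicator_of_mem h]
    refine le_trans ?_ (Finset.single_le_sum hi (Finset.mem_univ i))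
    rw [Set.indicator_of_mem h']
  · rw [Set.indicator_of_notMem h]
    exact Finset.sum_nonneg hi

theorem sum_fin_succ_eq {n : ℕ} (F : (Fin (n + 1) → α) → ℝ) :
    ∑ P, F P = ∑ a, ∑ P : Fin n → α, F (Fin.cons a P) := by
  rw [← Fintype.sum_prod_type']
  exact (Fintype.sum_equiv (Fin.consEquiv fun _ => α) _ _ fun _ => rfl).symm

theorem first_moment_iid {f : α → ℝ} (hs : ∑ a, p a = 1) (hf : ∑ a, p a * f a = 0) (n : ℕ) :
    ∑ P : Fin n → α, (∏ t, p (P t)) * ∑ t, f (P t) = 0 := by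
  induction n with
  | zero => simp
  | succ n ih =>
    rw [sum_fin_succ_eq]
    simp only [Fin.prod_univ_succ, Fin.sum_univ_succ, Fin.cons_zero, Fin.cons_succ]
    have : ∀ a, ∑ P : Fin n → α, p a * (∏ t, p (P t)) * (f a + ∑ t, f (P t)) =
        p a * f a * ∑ P : Fin n → α, ∏ t, p (P t) +
          p a * ∑ P : Fin n → α, (∏ t, p (P t)) * ∑ t, f (P t) := by
      intro a
      rw [Finset.mul_sum, Finset.mul_sum, ← Finset.sum_add_distrib]
      exact Finset.sum_congr rfl fun P _ => by ring
    simp only [this, ih, sum_prod_fin_eq_one hs, mul_one, mul_zero, add_zero, hf]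

/-- Splitting off the first draw, the cross term vanishes by `first_moment_iid` since the statistic
is centred. -/
theorem second_moment_iid {f : α → ℝ} (hs : ∑ a, p a = 1) (hf : ∑ a, p a * f a = 0) (n : ℕ) :
    ∑ P : Fin n → α, (∏ t, p (P t)) * (∑ t, f (P t)) ^ 2 = n * ∑ a, p a * f a ^ 2 := by
  induction n with
  | zero => simp
  | succ n ih =>
    rw [sum_fin_succ_eq]
    simp only [Fin.prod_univ_succ, Fin.sum_univ_succ, Fin.cons_zero, Fin.cons_succ]
    have : ∀ a, ∑ P : Fin n → α, p a * (∏ t, p (P t)) * (f a + ∑ t, f (P t)) ^ 2 =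
        p a * f a ^ 2 * ∑ P : Fin n → α, ∏ t, p (P t) +
        (2 * p a * f a * ∑ P : Fin n → α, (∏ t, p (P t)) * ∑ t, f (P t) +
          p a * ∑ P : Fin n → α, (∏ t, p (P t)) * (∑ t, f (P t)) ^ 2) := by
      intro a
      rw [Finset.mul_sum, Finset.mul_sum, Finset.mul_sum, ← Finset.sum_add_distrib,
        ← Finset.sum_add_distrib]
      exact Finset.sum_congr rfl fun P _ => by ring
    simp only [this, ih, sum_prod_fin_eq_one hs, first_moment_iid hs hf, mul_one, mul_zero,
      zero_add]
    rw [Finset.sum_add_distrib, ← Finset.sum_mul, hs]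
    push_cast
    ring

theorem chebyshev_iid {f : α → ℝ} (hp : ∀ a, 0 ≤ p a) (hs : ∑ a, p a = 1)
    (hf : ∑ a, p a * f a = 0) {n : ℕ} {r : ℝ} (hr : 0 < r) :
    iidProb p n {P | r ≤ |∑ t, f (P t)|} ≤ n * (∑ a, p a * f a ^ 2) / r ^ 2 := by
  rw [le_div_iff₀ (by positivity), ← second_moment_iid hs hf, iidProb, Finset.sum_mul]
  refine Finset.sum_le_sum fun P _ => ?_
  have hnn : 0 ≤ ∏ t, p (P t) := Finset.prod_nonneg fun _ _ => hp _
  by_cases h : P ∈ {P : Fin n → α | r ≤ |∑ t, f (P t)|}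
  · rw [Set.indicator_of_mem h]
    refine mul_le_mul_of_nonneg_left ?_ hnn
    rw [← sq_abs (∑ t, f (P t))]
    exact pow_le_pow_left₀ hr.le h 2
  · rw [Set.indicator_of_notMem h, zero_mul]
    positivity

/-- The weak law of large numbers for finitely many statistics of a finite distribution. -/
theorem tendsto_iidProb_mean_mem {ι : Type*} [Fintype ι] (hp : ∀ a, 0 ≤ p a)
    (hs : ∑ a, p a = 1) (f : α → ι → ℝ) {V : Set (ι → ℝ)}
    (hV : V ∈ 𝓝 fun i => ∑ a, p a * f a i) :
    Tendsto (fun n : ℕ => iidProb p n {P | (fun i => (∑ t, f (P t) i) / n) ∈ V})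
      atTop (𝓝 1) := by
  obtain ⟨δ, hδ, hball⟩ := Metric.mem_nhds_iff.1 hV
  set E : ι → ℝ := fun i => ∑ a, p a * f a i with hE
  set c : ι → α → ℝ := fun i a => f a i - E i with hc
  have hc0 : ∀ i, ∑ a, p a * c i a = 0 := by
    intro i
    simp only [hc, mul_sub, Finset.sum_sub_distrib, ← Finset.sum_mul, hs, hE, one_mul, sub_self]
  set C : ℝ := (∑ i, ∑ a, p a * c i a ^ 2) / δ ^ 2 with hC
  have hlim : Tendsto (fun n : ℕ => 1 - C / n) atTop (𝓝 1) := by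
    simpa using (tendsto_const_div_atTop_nhds_zero_nat C).const_sub 1
  refine tendsto_of_tendsto_of_tendsto_of_le_of_le' hlim tendsto_const_nhds ?_
    (Eventually.of_forall fun n => iidProb_le_one hp hs _)
  filter_upwards [eventually_gt_atTop 0] with n hn
  have hn' : (0 : ℝ) < n := by exact_mod_cast hn
  -- Leaving the `δ`-ball means that some coordinate deviates by at least `δ`; the union bound and
  -- Chebyshev's inequality then give `C / n`.
  have key : ({P : Fin n → α | (fun i => (∑ t, f (P t) i) / n) ∈ V})ᶜ ⊆
      ⋃ i, {P : Fin n → α | n * δ ≤ |∑ t, c i (P t)|} := by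
    intro P hP
    by_contra hcon
    apply hP
    apply hball
    rw [Metric.mem_ball, dist_pi_lt_iff hδ]
    intro i
    have h1 : |∑ t, c i (P t)| < n * δ := by
      by_contra h2
      exact hcon (Set.mem_iUnion.2 ⟨i, not_lt.1 h2⟩)
    have h3 : ∑ t, c i (P t) = (∑ t, f (P t) i) - n * E i := by
      simp [hc, Finset.sum_sub_distrib]
    rw [Real.dist_eq]
    have h4 : (∑ t, f (P t) i) / n - E i = (∑ t, c i (P t)) / n := by
      rw [h3]; field_simp
    rw [h4, abs_div, abs_of_pos hn', div_lt_iff₀ hn', mul_comm]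
    exact h1
  have h5 : iidProb p n ({P : Fin n → α | (fun i => (∑ t, f (P t) i) / n) ∈ V})ᶜ ≤ C / n := by
    refine (iidProb_mono hp key).trans ((iidProb_iUnion_le hp _).trans ?_)
    refine (Finset.sum_le_sum fun i _ => chebyshev_iid hp hs (hc0 i) (by positivity)).trans ?_
    rw [← Finset.sum_div, ← Finset.mul_sum, hC]
    apply le_of_eq
    field_simp
  linarith [iidProb_add_compl hs {P : Fin n → α | (fun i => (∑ t, f (P t) i) / n) ∈ V}]

/-- Two events of probability above `1 / 2` cannot be disjoint. This yields one profile that has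
typical frequencies and whose maximizers are also close to the truth. -/
theorem exists_mem_of_tendsto_iidProb (hp : ∀ a, 0 ≤ p a) (hs : ∑ a, p a = 1)
    {S T : (n : ℕ) → Set (Fin n → α)}
    (hS : Tendsto (fun n => iidProb p n (S n)) atTop (𝓝 1))
    (hT : Tendsto (fun n => iidProb p n (T n)) atTop (𝓝 1)) :
    ∃ n, (S n ∩ T n).Nonempty := by
  obtain ⟨n, h1, h2⟩ := ((hS.eventually_const_lt (show (1 / 2 : ℝ) < 1 by norm_num)).and
    (hT.eventually_const_lt (show (1 / 2 : ℝ) < 1 by norm_num))).exists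
  refine ⟨n, ?_⟩
  by_contra hne
  rw [Set.not_nonempty_iff_eq_empty] at hne
  have h3 : T n ⊆ (S n)ᶜ := fun P hP hP' => by
    have : P ∈ S n ∩ T n := ⟨hP', hP⟩
    rw [hne] at this
    exact this
  linarith [iidProb_add_compl hs (S n), iidProb_mono hp h3]

end IID

/-! ### Integrals of finite-valued statistics -/

section FiniteValued

variable {X β : Type*} [MeasurableSpace X] {μ : Measure X} [IsFiniteMeasure μ]
  [Finite β] [MeasurableSpace β] [DiscreteMeasurableSpace β]

theorem exists_abs_le_of_finite {β : Type*} [Finite β] (h : β → ℝ) : ∃ C, 0 ≤ C ∧ ∀ b, |h b| ≤ C := by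
  obtain ⟨C, hC⟩ := (Set.finite_range fun b => |h b|).bddAbove
  exact ⟨max C 0, le_max_right _ _, fun b => le_max_of_le_left (hC ⟨b, rfl⟩)⟩

theorem integrable_comp_of_finite {ρ : X → β} (hρ : Measurable ρ) (h : β → ℝ) :
    Integrable (fun x => h (ρ x)) μ := by
  obtain ⟨C, -, hC⟩ := exists_abs_le_of_finite h
  exact Integrable.of_bound ((Measurable.of_discrete (f := h)).comp hρ).aestronglyMeasurable C
    (Eventually.of_forall fun x => hC _)

/-- Dominated convergence where pointwise convergence is eventual equality. It is applied to
comparison relations on `Fin m`, which form a finite discrete type. -/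
theorem tendsto_integral_comp_of_eventually_eq {ι : Type*} {L : Filter ι} [L.IsCountablyGenerated]
    {ρ : ι → X → β} {ρ₀ : X → β} (hρ : ∀ s, Measurable (ρ s)) (h : β → ℝ)
    (hlim : ∀ᵐ x ∂μ, ∀ᶠ s in L, ρ s x = ρ₀ x) :
    Tendsto (fun s => ∫ x, h (ρ s x) ∂μ) L (𝓝 (∫ x, h (ρ₀ x) ∂μ)) := by
  obtain ⟨C, -, hC⟩ := exists_abs_le_of_finite h
  refine tendsto_integral_filter_of_dominated_convergence (fun _ => C)
    (Eventually.of_forall fun s =>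
      ((Measurable.of_discrete (f := h)).comp (hρ s)).aestronglyMeasurable)
    (Eventually.of_forall fun s => Eventually.of_forall fun x => hC _) (integrable_const _) ?_
  filter_upwards [hlim] with x hx
  refine tendsto_const_nhds.congr' ?_
  filter_upwards [hx] with s hs
  rw [hs]

end FiniteValued

/-! ### The law on the line with a given density -/

section Shape

/-- The law on the real line with density `f`. -/
def shapeLaw (f : ℝ → ℝ) : Measure ℝ := volume.withDensity fun x => ENNReal.ofReal (f x)

variable {f : ℝ → ℝ}

theorem IsUtilityDensity.isProbabilityMeasure (hf : IsUtilityDensity f) :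
    IsProbabilityMeasure (shapeLaw f) := by
  refine ⟨?_⟩
  rw [shapeLaw, withDensity_apply _ MeasurableSet.univ, Measure.restrict_univ,
    ← ofReal_integral_eq_lintegral_ofReal hf.integrable
      (Eventually.of_forall fun x => (hf.pos x).le), hf.integral_eq_one, ENNReal.ofReal_one]

theorem IsUtilityDensity.isOpenPosMeasure (hf : IsUtilityDensity f) :
    (shapeLaw f).IsOpenPosMeasure := by
  refine Measure.AbsolutelyContinuous.isOpenPosMeasure (μ := volume)
    (withDensity_absolutelyContinuous' ?_ ?_)
  · exact hf.continuous.measurable.ennreal_ofReal.aemeasurable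
  · exact Eventually.of_forall fun x => by simpa using hf.pos x

theorem nullSingletonClass_shapeLaw (f : ℝ → ℝ) : NullSingletonClass (shapeLaw f) :=
  ⟨fun x => withDensity_absolutelyContinuous _ _ (measure_singleton x)⟩

theorem isNegInvariant_shapeLaw (hs : ∀ x, f (-x) = f x) :
    (shapeLaw f).IsNegInvariant := by
  refine ⟨?_⟩
  ext s hsm
  rw [Measure.neg, Measure.map_apply measurable_neg hsm, shapeLaw,
    withDensity_apply _ (measurable_neg hsm), withDensity_apply _ hsm,
    ← lintegral_indicator (measurable_neg hsm), ← lintegral_indicator hsm]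
  conv_rhs => rw [← lintegral_neg_eq_self]
  refine lintegral_congr fun x => ?_
  simp only [Set.indicator, hs]
  rfl

theorem map_add_shapeLaw (f : ℝ → ℝ) (c : ℝ) :
    (shapeLaw f).map (fun x => x + c) = shapeLaw fun x => f (x - c) := by
  ext s hsm
  have hm : Measurable fun x : ℝ => x + c := measurable_id.add_const c
  rw [Measure.map_apply hm hsm, shapeLaw, shapeLaw, withDensity_apply _ (hm hsm),
    withDensity_apply _ hsm, ← lintegral_indicator (hm hsm), ← lintegral_indicator hsm]
  conv_rhs => rw [← lintegral_add_right_eq_self _ c]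
  refine lintegral_congr fun x => ?_
  simp only [Set.indicator, add_sub_cancel_right]
  rfl

end Shape

/-! ### Independent noise and pairwise win probabilities -/

section Noise

variable {m : ℕ}

/-- The relation "`i` has lower utility than `c`" for the utilities `x + θ`. -/
def belowRel (θ x : Fin m → ℝ) : Fin m → Fin m → Prop := fun i c => x i + θ i < x c + θ c

theorem measurable_belowRel (θ : Fin m → ℝ) : Measurable (belowRel θ) := by
  refine measurable_pi_lambda _ fun i => measurable_pi_lambda _ fun c => ?_
  refine measurableSet_setOfPred.1 (measurableSet_lt ?_ ?_) <;> fun_prop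

open Classical in
/-- The number of alternatives above `i`. -/
def place (r : Fin m → Fin m → Prop) (i : Fin m) : Fin m :=
  -- Excluding `i` keeps the count below `m` for every relation, even one that is not irreflexive.
  ⟨(Finset.univ.filter fun c => c ≠ i ∧ r i c).card, by
    conv_rhs => rw [← Fintype.card_fin m]
    exact Finset.card_lt_univ_of_notMem (x := i) (by simp)⟩

open Classical in
/-- The weight extracted for "`i` above `j`". -/
def reward (g : Fin m → Fin m → ℝ) (i j : Fin m) (r : Fin m → Fin m → Prop) : ℝ :=
  if r j i then g (place r i) (place r j) else 0

theorem reward_of_rel {g : Fin m → Fin m → ℝ} {i j : Fin m} {r : Fin m → Fin m → Prop}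
    (h : r j i) : reward g i j r = g (place r i) (place r j) := if_pos h

theorem reward_of_not_rel {g : Fin m → Fin m → ℝ} {i j : Fin m} {r : Fin m → Fin m → Prop}
    (h : ¬ r j i) : reward g i j r = 0 := if_neg h

variable (ν : Fin m → Measure ℝ)

/-- The probability that `i` beats `j` when its location exceeds that of `j` by `d`. -/
def pairCdf (i j : Fin m) (d : ℝ) : ℝ := (Measure.pi ν).real {x | x j < x i + d}

/-- The expected weight extracted for "`i` above `j`". -/
def meanReward (g : Fin m → Fin m → ℝ) (θ : Fin m → ℝ) (i j : Fin m) : ℝ :=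
  ∫ x, reward g i j (belowRel θ x) ∂Measure.pi ν

variable [∀ i, IsProbabilityMeasure (ν i)]

theorem map_pair_pi {i j : Fin m} (hij : i ≠ j) :
    (Measure.pi ν).map (fun x => (x i, x j)) = (ν i).prod (ν j) := by
  have h := ((ProbabilityTheory.iIndepFun_pi (μ := ν) (X := fun _ => id)
    (fun i => aemeasurable_id)).indepFun hij).map_prod_eq_prod_map_map
    (measurable_pi_apply i).aemeasurable (measurable_pi_apply j).aemeasurable
  rw [show (Measure.pi ν).map (fun x => (x i, x j)) = _ from h]
  change ((Measure.pi ν).map fun x => x i).prod ((Measure.pi ν).map fun x => x j) = _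
  rw [ (measurePreserving_eval ν i).map_eq, (measurePreserving_eval ν j).map_eq]

theorem measurableSet_pair_lt (i j : Fin m) (d : ℝ) :
    MeasurableSet {x : Fin m → ℝ | x j < x i + d} := by
  refine measurableSet_lt ?_ ?_ <;> fun_prop

theorem pairCdf_le_one (i j : Fin m) (d : ℝ) : pairCdf ν i j d ≤ 1 := measureReal_le_one

theorem pairCdf_eq_integral {i j : Fin m} (hij : i ≠ j) (d : ℝ) :
    pairCdf ν i j d = ∫ y, (ν i).real (Set.Ioi (y - d)) ∂ν j := by
  have hm : MeasurableSet {p : ℝ × ℝ | p.1 < p.2 + d} := by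
    refine measurableSet_lt ?_ ?_ <;> fun_prop
  have h1 : pairCdf ν i j d = ((ν j).prod (ν i)).real {p : ℝ × ℝ | p.1 < p.2 + d} := by
    rw [← map_pair_pi ν hij.symm, pairCdf, measureReal_def, measureReal_def,
      Measure.map_apply (by fun_prop) hm]
    rfl
  rw [h1, measureReal_def, Measure.prod_apply hm, ← integral_toReal]
  · refine integral_congr_ae (Eventually.of_forall fun y => ?_)
    simp only [measureReal_def]
    congr 2
    ext z
    simp [sub_lt_iff_lt_add]
  · exact (measurable_measure_prodMk_left hm).aemeasurable
  · exact Eventually.of_forall fun y => measure_lt_top _ _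

theorem tendsto_pairCdf_atBot (i j : Fin m) : Tendsto (pairCdf ν i j) atBot (𝓝 0) := by
  have h := tendsto_measure_of_ae_tendsto_indicator_of_isFiniteMeasure (μ := Measure.pi ν) atBot
    (A := ∅) (As := fun d : ℝ => {x : Fin m → ℝ | x j < x i + d}) MeasurableSet.empty
    (measurableSet_pair_lt i j) (Eventually.of_forall fun x => by
      filter_upwards [eventually_le_atBot (x j - x i)] with d hd
      exact iff_of_false (fun h : x j < x i + d => by linarith) (Set.notMem_empty x))
  rw [measure_empty] at h
  exact (ENNReal.tendsto_toReal ENNReal.zero_ne_top).comp h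

theorem tendsto_pairCdf_atTop (i j : Fin m) : Tendsto (pairCdf ν i j) atTop (𝓝 1) := by
  have h := tendsto_measure_of_ae_tendsto_indicator_of_isFiniteMeasure (μ := Measure.pi ν) atTop
    (A := Set.univ) (As := fun d : ℝ => {x : Fin m → ℝ | x j < x i + d}) MeasurableSet.univ
    (measurableSet_pair_lt i j) (Eventually.of_forall fun x => by
      filter_upwards [eventually_gt_atTop (x j - x i)] with d hd
      exact iff_of_true (show x j < x i + d by linarith) (Set.mem_univ x))
  rw [measure_univ] at h
  exact (ENNReal.tendsto_toReal ENNReal.one_ne_top).comp h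

section OpenPos

variable [∀ i, (ν i).IsOpenPosMeasure]

theorem pairCdf_pos {i j : Fin m} (hij : i ≠ j) (d : ℝ) : 0 < pairCdf ν i j d := by
  refine ENNReal.toReal_pos (IsOpen.measure_ne_zero _ ?_ ?_) (measure_ne_top _ _)
  · exact isOpen_lt (by fun_prop) (by fun_prop)
  · exact ⟨Pi.single i (1 - d), by simp [hij.symm]⟩

theorem strictMono_pairCdf {i j : Fin m} (hij : i ≠ j) : StrictMono (pairCdf ν i j) := by
  intro d d' hd
  have hsub : {x : Fin m → ℝ | x j < x i + d} ⊆ {x | x j < x i + d'} := fun x hx => by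
    simp only [Set.mem_ofPred_eq] at hx ⊢
    linarith
  have h := measureReal_sdiff (μ := Measure.pi ν) hsub (measurableSet_pair_lt i j d)
  have hpos : 0 < (Measure.pi ν).real ({x : Fin m → ℝ | x j < x i + d'} \ {x | x j < x i + d}) := by
    have ho : IsOpen {x : Fin m → ℝ | x i + d < x j ∧ x j < x i + d'} :=
      IsOpen.inter (s := {x : Fin m → ℝ | x i + d < x j}) (t := {x | x j < x i + d'})
        (isOpen_lt (by fun_prop) (by fun_prop)) (isOpen_lt (by fun_prop) (by fun_prop))
    have hne : {x : Fin m → ℝ | x i + d < x j ∧ x j < x i + d'}.Nonempty :=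
      ⟨Pi.single j ((d + d') / 2), by
        simp only [Set.mem_ofPred_eq, Pi.single_eq_same, Pi.single_eq_of_ne hij]
        constructor <;> linarith⟩
    refine lt_of_lt_of_le (ENNReal.toReal_pos (ho.measure_ne_zero (Measure.pi ν) hne)
      (measure_ne_top _ _)) ?_
    refine measureReal_mono fun x hx => ?_
    simp only [Set.mem_ofPred_eq, Set.mem_sdiff, not_lt] at hx ⊢
    exact ⟨hx.2, hx.1.le⟩
  rw [pairCdf, pairCdf]
  linarith

end OpenPos

section NoTies

variable [∀ i, NullSingletonClass (ν i)]

/-- By Fubini: for each value of `x i`, a tie confines `x j` to a single point. -/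
theorem ae_add_ne {i j : Fin m} (hij : i ≠ j) (d : ℝ) :
    ∀ᵐ x ∂Measure.pi ν, x j ≠ x i + d := by
  have hm : MeasurableSet {p : ℝ × ℝ | p.2 = p.1 + d} := by
    refine measurableSet_eq_fun ?_ ?_ <;> fun_prop
  have h0 : ((ν i).prod (ν j)) {p : ℝ × ℝ | p.2 = p.1 + d} = 0 := by
    rw [Measure.measure_prod_null hm]
    refine Eventually.of_forall fun y => ?_
    have : Prod.mk y ⁻¹' {p : ℝ × ℝ | p.2 = p.1 + d} = {y + d} := by ext z; simp
    simp only [this, measure_singleton, Pi.zero_apply]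
  rw [← map_pair_pi ν hij, Measure.map_apply (by fun_prop) hm] at h0
  rw [ae_iff]
  simpa using h0

theorem ae_injective_add (θ : Fin m → ℝ) :
    ∀ᵐ x ∂Measure.pi ν, Function.Injective fun i => x i + θ i := by
  have h : ∀ᵐ x ∂Measure.pi ν, ∀ i j : Fin m, i ≠ j → x j ≠ x i + (θ i - θ j) := by
    simp only [ae_all_iff]
    exact fun i j hij => ae_add_ne ν hij _
  filter_upwards [h] with x hx i j hij
  by_contra hne
  exact hx i j hne (by simp only at hij; linarith)

theorem pairCdf_add_swap {i j : Fin m} (hij : i ≠ j) (d : ℝ) :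
    pairCdf ν i j d + pairCdf ν j i (-d) = 1 := by
  have h : pairCdf ν j i (-d) = (Measure.pi ν).real {x | x j < x i + d}ᶜ := by
    refine measureReal_congr ?_
    filter_upwards [ae_add_ne ν hij d] with x hx
    refine propext ?_
    change x i < x j + -d ↔ ¬ (x j < x i + d)
    rw [not_lt]
    constructor
    · intro h; linarith
    · intro h
      have := lt_of_le_of_ne h hx.symm
      linarith
  rw [h, pairCdf]
  exact probReal_add_probReal_compl (measurableSet_pair_lt i j d)

theorem continuous_pairCdf {i j : Fin m} (hij : i ≠ j) : Continuous (pairCdf ν i j) := by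
  refine continuous_iff_continuousAt.2 fun d => ?_
  have h := tendsto_measure_of_ae_tendsto_indicator_of_isFiniteMeasure (μ := Measure.pi ν) (𝓝 d)
    (As := fun d : ℝ => {x : Fin m → ℝ | x j < x i + d}) (measurableSet_pair_lt i j d)
    (measurableSet_pair_lt i j) (by
      filter_upwards [ae_add_ne ν hij d] with x hx
      change ∀ᶠ e in 𝓝 d, (x j < x i + e ↔ x j < x i + d)
      rcases lt_or_gt_of_ne hx with h | h
      · filter_upwards [lt_mem_nhds (show x j - x i < d by linarith)] with e he
        exact iff_of_true (by linarith) h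
      · filter_upwards [gt_mem_nhds (show d < x j - x i by linarith)] with e he
        exact iff_of_false (by linarith) (by linarith))
  exact (ENNReal.tendsto_toReal (measure_ne_top _ _)).comp h

end NoTies

end Noise

/-! ### Rankings recovered from utilities -/

section Rankings

variable {m : ℕ}

theorem exists_ranking_of_injective {u : Fin m → ℝ} (hu : Function.Injective u) :
    ∃ R : Ranking m, ∀ k l, k < l → u (R l) < u (R k) := by
  refine ⟨Tuple.sort fun i => -u i, fun k l hkl => ?_⟩
  have h1 : -u (Tuple.sort (fun i => -u i) k) ≤ -u (Tuple.sort (fun i => -u i) l) :=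
    Tuple.monotone_sort (fun i => -u i) hkl.le
  refine lt_of_le_of_ne (by linarith) fun h => ?_
  exact hkl.ne' ((Tuple.sort fun i => -u i).injective (hu h))

theorem symm_lt_symm_iff {u : Fin m → ℝ} {R : Ranking m}
    (hR : ∀ k l, k < l → u (R l) < u (R k)) (i j : Fin m) :
    R.symm i < R.symm j ↔ u j < u i := by
  constructor
  · intro h
    simpa using hR _ _ h
  · intro h
    by_contra hn
    rcases (not_lt.1 hn).lt_or_eq with h1 | h1
    · have := hR _ _ h1
      simp only [Equiv.apply_symm_apply] at this
      linarith
    · rw [R.symm.injective h1] at h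
      exact lt_irrefl _ h

/-- The alternatives above `i` are the images under `R` of the positions before `R.symm i`. -/
theorem place_eq_symm {u : Fin m → ℝ} {R : Ranking m}
    (hR : ∀ k l, k < l → u (R l) < u (R k)) (i : Fin m) :
    place (fun i c => u i < u c) i = R.symm i := by
  classical
  apply Fin.ext
  change (Finset.univ.filter fun c => c ≠ i ∧ u i < u c).card = (R.symm i : ℕ)
  have : (Finset.univ.filter fun c => c ≠ i ∧ u i < u c) =
      (Finset.univ.filter fun k => k < R.symm i).map R.toEmbedding := by
    ext c
    simp only [Finset.mem_filter, Finset.mem_univ, true_and, Finset.mem_map,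
      Equiv.toEmbedding_apply]
    constructor
    · rintro ⟨-, h⟩
      exact ⟨R.symm c, (symm_lt_symm_iff hR _ _).2 h, by simp⟩
    · rintro ⟨k, hk, rfl⟩
      have : u i < u (R k) := (symm_lt_symm_iff hR _ _).1 (by simpa using hk)
      exact ⟨fun h => by rw [h] at this; exact lt_irrefl _ this, this⟩
  convert congrArg Finset.card this using 1
  rw [Finset.card_map, ← Fin.card_Iio (R.symm i)]
  congr 1
  ext k
  rw [Finset.mem_Iio, Finset.mem_filter, and_iff_right (Finset.mem_univ _)]

theorem eq_of_strictAnti_ranking {u : Fin m → ℝ} {R R' : Ranking m}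
    (hR : ∀ k l, k < l → u (R l) < u (R k)) (hR' : ∀ k l, k < l → u (R' l) < u (R' k)) :
    R = R' := by
  have h : R.symm = R'.symm := Equiv.ext fun i => by
    rw [← place_eq_symm hR, ← place_eq_symm hR']
  simpa using congrArg Equiv.symm h

theorem extract_eq_reward (G : Breaking m) {u : Fin m → ℝ} {R : Ranking m}
    (hR : ∀ k l, k < l → u (R l) < u (R k)) (i j : Fin m) :
    G.extract R i j = reward G.weight i j fun i c => u i < u c := by
  simp only [Breaking.extract, reward, symm_lt_symm_iff hR, place_eq_symm hR]

theorem integrable_reward (ν : Fin m → Measure ℝ) [∀ i, IsProbabilityMeasure (ν i)]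
    (g : Fin m → Fin m → ℝ) (θ : Fin m → ℝ) (i j : Fin m) :
    Integrable (fun x => reward g i j (belowRel θ x)) (Measure.pi ν) :=
  integrable_comp_of_finite (measurable_belowRel θ) _

end Rankings

/-! ### From the random utility model to fixed noise -/

section Laws

variable {m : ℕ} {π : Fin m → ℝ → ℝ}

/-- All parameters can thus be treated on one probability space, with `θ` entering only as a shift.
-/
theorem utilityLaw_eq_map (hπ : ∀ i, IsUtilityDensity (π i)) (θ : Fin m → ℝ) :
    utilityLaw π θ = (Measure.pi fun i => shapeLaw (π i)).map fun x i => x i + θ i := by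
  have : ∀ i, IsProbabilityMeasure (shapeLaw (π i)) := fun i => (hπ i).isProbabilityMeasure
  have hm : ∀ i, AEMeasurable (fun x : ℝ => x + θ i) (shapeLaw (π i)) := fun i => by fun_prop
  have : ∀ i, IsProbabilityMeasure ((shapeLaw (π i)).map fun x => x + θ i) := fun i =>
    Measure.isProbabilityMeasure_map (hm i)
  rw [Measure.pi_map_pi hm, utilityLaw]
  congr 1
  funext i
  rw [map_add_shapeLaw, shapeLaw]

theorem utilityLaw_real (hπ : ∀ i, IsUtilityDensity (π i)) (θ : Fin m → ℝ)
    {S : Set (Fin m → ℝ)} (hS : MeasurableSet S) :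
    (utilityLaw π θ).real S =
      (Measure.pi fun i => shapeLaw (π i)).real {x | (fun i => x i + θ i) ∈ S} := by
  rw [utilityLaw_eq_map hπ, measureReal_def, measureReal_def, Measure.map_apply (by fun_prop) hS]
  rfl

theorem pairProb_eq_pairCdf (hπ : ∀ i, IsUtilityDensity (π i)) (θ : Fin m → ℝ) (i j : Fin m) :
    pairProb π θ i j = pairCdf (fun i => shapeLaw (π i)) i j (θ i - θ j) := by
  rw [pairProb, utilityLaw_real hπ _ (measurableSet_lt (by fun_prop) (by fun_prop)), pairCdf]
  congr 1
  ext x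
  simp only [Set.mem_ofPred_eq]
  constructor <;> intro h <;> linarith

theorem measurableSet_ranking (R : Ranking m) :
    MeasurableSet {u : Fin m → ℝ | ∀ k l : Fin m, k < l → u (R l) < u (R k)} := by
  simp only [Set.ofPred_forall]
  exact MeasurableSet.iInter fun k => MeasurableSet.iInter fun l => MeasurableSet.iInter fun _ =>
    measurableSet_lt (by fun_prop) (by fun_prop)

theorem rankingProb_nonneg (θ : Fin m → ℝ) (R : Ranking m) : 0 ≤ rankingProb π θ R :=
  measureReal_nonneg

/-- Averaging a statistic of the ranking amounts to integrating it over the utilities. -/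
theorem sum_rankingProb_mul (hπ : ∀ i, IsUtilityDensity (π i)) (θ : Fin m → ℝ)
    (F : Ranking m → ℝ) (H : (Fin m → ℝ) → ℝ)
    (hFH : ∀ (u : Fin m → ℝ) (R : Ranking m), (∀ k l, k < l → u (R l) < u (R k)) → F R = H u) :
    ∑ R, rankingProb π θ R * F R =
      ∫ x, H (fun i => x i + θ i) ∂Measure.pi fun i => shapeLaw (π i) := by
  have : ∀ i, IsProbabilityMeasure (shapeLaw (π i)) := fun i => (hπ i).isProbabilityMeasure
  have : ∀ i, NullSingletonClass (shapeLaw (π i)) := fun i => nullSingletonClass_shapeLaw _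
  set μ := Measure.pi fun i => shapeLaw (π i) with hμ
  let E : Ranking m → Set (Fin m → ℝ) := fun R =>
    {x | ∀ k l : Fin m, k < l → x (R l) + θ (R l) < x (R k) + θ (R k)}
  have hE : ∀ R, MeasurableSet (E R) := fun R =>
    (by fun_prop : Measurable fun (x : Fin m → ℝ) i => x i + θ i) (measurableSet_ranking R)
  have h1 : ∀ R, rankingProb π θ R * F R = ∫ x, (E R).indicator (fun _ => F R) x ∂μ := by
    intro R
    rw [rankingProb, utilityLaw_real hπ _ (measurableSet_ranking R),
      integral_indicator_const _ (hE R), smul_eq_mul]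
    rfl
  simp only [h1]
  rw [← integral_finsetSum _ fun R _ => (integrable_const (F R)).indicator (hE R)]
  refine integral_congr_ae ?_
  filter_upwards [ae_injective_add (fun i => shapeLaw (π i)) θ] with x hx
  obtain ⟨R, hR⟩ := exists_ranking_of_injective hx
  -- Without ties exactly one ranking is compatible with the utilities, so a single indicator
  -- survives.
  rw [Finset.sum_eq_single R]
  · rw [Set.indicator_of_mem (show x ∈ E R from hR)]
    exact hFH _ R hR
  · intro R' _ hne
    refine Set.indicator_of_notMem (fun hR' => hne ?_) _
    exact eq_of_strictAnti_ranking (u := fun i => x i + θ i) hR' hR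
  · simp

theorem sum_rankingProb (hπ : ∀ i, IsUtilityDensity (π i)) (θ : Fin m → ℝ) :
    ∑ R, rankingProb π θ R = 1 := by
  have : ∀ i, IsProbabilityMeasure (shapeLaw (π i)) := fun i => (hπ i).isProbabilityMeasure
  simpa using sum_rankingProb_mul hπ θ (fun _ => 1) (fun _ => 1) fun _ _ _ => rfl

theorem sum_rankingProb_mul_extract (hπ : ∀ i, IsUtilityDensity (π i)) (G : Breaking m)
    (θ : Fin m → ℝ) (i j : Fin m) :
    ∑ R, rankingProb π θ R * G.extract R i j =
      meanReward (fun i => shapeLaw (π i)) G.weight θ i j :=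
  sum_rankingProb_mul hπ θ _ (fun u => reward G.weight i j fun i c => u i < u c)
    fun _ _ hR => extract_eq_reward G hR i j

end Laws

/-! ### The composite likelihood and its maximizers -/

section Objective

variable {m : ℕ} (ν : Fin m → Measure ℝ)

/-- The composite log-marginal likelihood as a function of the comparison weights and the
parameter. -/
def compLik (w : ℝ) (κ : Fin m × Fin m → ℝ) (θ : Fin m → ℝ) : ℝ :=
  ∑ q ∈ (Finset.univ : Finset (Fin m)).offDiag,
    κ q * w * Real.log (pairCdf ν q.1 q.2 (θ q.1 - θ q.2))

theorem cll_eq_compLik {π : Fin m → ℝ → ℝ} (hπ : ∀ i, IsUtilityDensity (π i)) (G : Breaking m)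
    {W : CMLWeight m} {w : ℝ} (hW : ∀ i j, i ≠ j → W.weight i j = w) {n : ℕ} (P : Profile m n)
    (θ : Fin m → ℝ) :
    cll π G W P θ =
      compLik (fun i => shapeLaw (π i)) w (fun q => (∑ t, G.extract (P t) q.1 q.2) / n) θ := by
  refine Finset.sum_congr rfl fun q hq => ?_
  rw [hW _ _ (Finset.mem_offDiag.1 hq).2.2, pairProb_eq_pairCdf hπ]
  rfl

theorem compLik_congr_sub (w : ℝ) (κ : Fin m × Fin m → ℝ) {θ θ' : Fin m → ℝ}
    (h : ∀ i j, θ i - θ j = θ' i - θ' j) : compLik ν w κ θ = compLik ν w κ θ' := by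
  simp only [compLik, h]

theorem meanReward_congr_sub (g : Fin m → Fin m → ℝ) {θ θ' : Fin m → ℝ}
    (h : ∀ i j, θ i - θ j = θ' i - θ' j) (i j : Fin m) :
    meanReward ν g θ i j = meanReward ν g θ' i j := by
  have : belowRel θ = belowRel θ' := by
    funext x i c
    refine propext ?_
    have := h i c
    simp only [belowRel]
    constructor <;> intro h <;> linarith
  rw [meanReward, meanReward, this]

theorem isClosed_paramSpace (m : ℕ) : IsClosed (paramSpace m) := by
  simp only [paramSpace, Set.ofPred_forall]
  exact isClosed_iInter fun i => isClosed_iInter fun _ =>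
    isClosed_eq (continuous_apply i) continuous_const

variable [∀ i, IsProbabilityMeasure (ν i)] [∀ i, (ν i).IsOpenPosMeasure]
  [∀ i, NullSingletonClass (ν i)]

theorem continuous_log_pairCdf {i j : Fin m} (hij : i ≠ j) :
    Continuous fun θ : Fin m → ℝ => Real.log (pairCdf ν i j (θ i - θ j)) :=
  Continuous.log ((continuous_pairCdf ν hij).comp (by fun_prop))
    fun θ => (pairCdf_pos ν hij _).ne'

theorem continuous_compLik (w : ℝ) :
    Continuous fun z : (Fin m × Fin m → ℝ) × (Fin m → ℝ) => compLik ν w z.1 z.2 := by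
  refine continuous_finsetSum _ fun q hq => ?_
  have h1 : Continuous fun z : (Fin m × Fin m → ℝ) × (Fin m → ℝ) => z.1 q * w := by fun_prop
  exact h1.mul
    ((continuous_log_pairCdf ν (Finset.mem_offDiag.1 hq).2.2).comp continuous_snd)

omit [∀ i, (ν i).IsOpenPosMeasure] [∀ i, NullSingletonClass (ν i)] in
theorem log_pairCdf_nonpos (i j : Fin m) (d : ℝ) : Real.log (pairCdf ν i j d) ≤ 0 :=
  Real.log_nonpos measureReal_nonneg (pairCdf_le_one ν i j d)

omit [∀ i, (ν i).IsOpenPosMeasure] in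
-- The two orders of a pair have total probability one, so the sum of all win probabilities is
-- independent of `θ`. This cancels the linear terms in Gibbs' inequality.
theorem sum_pairCdf_offDiag (θ : Fin m → ℝ) :
    2 * ∑ q ∈ (Finset.univ : Finset (Fin m)).offDiag, pairCdf ν q.1 q.2 (θ q.1 - θ q.2) =
      ∑ _q ∈ (Finset.univ : Finset (Fin m)).offDiag, (1 : ℝ) := by
  have h : ∑ q ∈ (Finset.univ : Finset (Fin m)).offDiag, pairCdf ν q.1 q.2 (θ q.1 - θ q.2) =
      ∑ q ∈ (Finset.univ : Finset (Fin m)).offDiag, pairCdf ν q.2 q.1 (θ q.2 - θ q.1) :=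
    Finset.sum_nbij' Prod.swap Prod.swap (by simp [eq_comm]) (by simp [eq_comm])
      (by simp) (by simp) (by simp)
  rw [two_mul]
  nth_rewrite 2 [h]
  rw [← Finset.sum_add_distrib]
  refine Finset.sum_congr rfl fun q hq => ?_
  rw [← neg_sub (θ q.1) (θ q.2)]
  exact pairCdf_add_swap ν (Finset.mem_offDiag.1 hq).2.2 _

/-- Gibbs' inequality: the expected composite likelihood identifies the parameter. -/
theorem compLik_lt_of_ne {c w : ℝ} (hc : 0 < c) (hw : 0 < w) {θ θ₀ : Fin m → ℝ}
    (h : ∃ i j, i ≠ j ∧ θ i - θ j ≠ θ₀ i - θ₀ j) :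
    compLik ν w (fun q => c * pairCdf ν q.1 q.2 (θ₀ q.1 - θ₀ q.2)) θ <
      compLik ν w (fun q => c * pairCdf ν q.1 q.2 (θ₀ q.1 - θ₀ q.2)) θ₀ := by
  obtain ⟨i, j, hij, hne⟩ := h
  have hcw : 0 < c * w := mul_pos hc hw
  set p : Fin m × Fin m → ℝ := fun q => pairCdf ν q.1 q.2 (θ q.1 - θ q.2) with hp
  set p₀ : Fin m × Fin m → ℝ := fun q => pairCdf ν q.1 q.2 (θ₀ q.1 - θ₀ q.2) with hp₀
  have hppos : ∀ q ∈ (Finset.univ : Finset (Fin m)).offDiag, 0 < p q ∧ 0 < p₀ q := fun q hq =>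
    ⟨pairCdf_pos ν (Finset.mem_offDiag.1 hq).2.2 _, pairCdf_pos ν (Finset.mem_offDiag.1 hq).2.2 _⟩
  have hterm : ∀ q ∈ (Finset.univ : Finset (Fin m)).offDiag,
      c * p₀ q * w * Real.log (p q) - c * p₀ q * w * Real.log (p₀ q) =
        c * w * (p₀ q * Real.log (p q / p₀ q)) := fun q hq => by
    rw [Real.log_div (hppos q hq).1.ne' (hppos q hq).2.ne']
    ring
  -- From `log x ≤ x - 1` at `x = p / p₀`, with strict inequality for the pair `(i, j)`, where `p ≠
  -- p₀`.
  have hle : ∀ q ∈ (Finset.univ : Finset (Fin m)).offDiag,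
      c * w * (p₀ q * Real.log (p q / p₀ q)) ≤ c * w * (p q - p₀ q) := fun q hq => by
    obtain ⟨h1, h2⟩ := hppos q hq
    refine mul_le_mul_of_nonneg_left ?_ hcw.le
    have := mul_le_mul_of_nonneg_left (Real.log_le_sub_one_of_pos (div_pos h1 h2)) h2.le
    rwa [mul_sub, mul_div_cancel₀ _ h2.ne', mul_one] at this
  have hlt : c * w * (p₀ (i, j) * Real.log (p (i, j) / p₀ (i, j))) <
      c * w * (p (i, j) - p₀ (i, j)) := by
    obtain ⟨h1, h2⟩ := hppos (i, j) (by simp [hij])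
    refine mul_lt_mul_of_pos_left ?_ hcw
    have h3 : p (i, j) / p₀ (i, j) ≠ 1 := fun h => hne
      ((strictMono_pairCdf ν hij).injective ((div_eq_one_iff_eq h2.ne').1 h))
    have := mul_lt_mul_of_pos_left (Real.log_lt_sub_one_of_pos (div_pos h1 h2) h3) h2
    rwa [mul_sub, mul_div_cancel₀ _ h2.ne', mul_one] at this
  have hsum : ∑ q ∈ (Finset.univ : Finset (Fin m)).offDiag, c * w * (p q - p₀ q) = 0 := by
    rw [← Finset.mul_sum, Finset.sum_sub_distrib]
    have h1 := sum_pairCdf_offDiag ν θ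
    have h2 := sum_pairCdf_offDiag ν θ₀
    rw [show (∑ q ∈ (Finset.univ : Finset (Fin m)).offDiag, p q) -
      ∑ q ∈ (Finset.univ : Finset (Fin m)).offDiag, p₀ q = 0 by simp only [hp, hp₀]; linarith,
      mul_zero]
  have := Finset.sum_lt_sum hle ⟨(i, j), by simp [hij], hlt⟩
  rw [hsum, ← Finset.sum_congr rfl hterm, Finset.sum_sub_distrib] at this
  simp only [compLik]
  linarith

/-- A single compact set `A` contains every parameter at least as good as `θ₀`, for all `κ` near the
expected weights. On the part of `A` at distance at least `ε` from `θ₀`, the strict Gibbs inequality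
survives small changes of `κ`. -/
theorem eventually_argmax_compLik {e : Fin m} (he : (e : ℕ) + 1 = m) {c w : ℝ} (hc : 0 < c)
    (hw : 0 < w) {θ₀ : Fin m → ℝ} (hθ₀ : θ₀ ∈ paramSpace m) {ε : ℝ} (hε : 0 < ε) :
    ∀ᶠ κ in 𝓝 (fun q : Fin m × Fin m => c * pairCdf ν q.1 q.2 (θ₀ q.1 - θ₀ q.2)),
      (∃ θ ∈ paramSpace m, IsMaxOn (compLik ν w κ) (paramSpace m) θ) ∧
        ∀ θ ∈ paramSpace m, IsMaxOn (compLik ν w κ) (paramSpace m) θ → dist θ θ₀ < ε := by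
  set K : Fin m × Fin m → ℝ := fun q => c * pairCdf ν q.1 q.2 (θ₀ q.1 - θ₀ q.2) with hK
  set b : ℝ := compLik ν w K θ₀ - 1 with hb
  have hKpos : ∀ q ∈ (Finset.univ : Finset (Fin m)).offDiag, 0 < K q := fun q hq =>
    mul_pos hc (pairCdf_pos ν (Finset.mem_offDiag.1 hq).2.2 _)
  set A : Set (Fin m → ℝ) := {θ | θ ∈ paramSpace m ∧
    ∀ q ∈ (Finset.univ : Finset (Fin m)).offDiag,
      b ≤ K q / 2 * w * Real.log (pairCdf ν q.1 q.2 (θ q.1 - θ q.2))} with hA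
  have hAclosed : IsClosed A := by
    refine IsClosed.inter (s₂ := {θ : Fin m → ℝ | ∀ q ∈ (Finset.univ : Finset (Fin m)).offDiag,
      b ≤ K q / 2 * w * Real.log (pairCdf ν q.1 q.2 (θ q.1 - θ q.2))}) (isClosed_paramSpace m) ?_
    simp only [Set.ofPred_forall]
    exact isClosed_iInter fun q => isClosed_iInter fun hq => isClosed_le continuous_const
      ((continuous_log_pairCdf ν (Finset.mem_offDiag.1 hq).2.2).const_mul _)
  -- Log-probabilities tend to `-∞` with the location difference, which bounds each difference
  -- below. Applied to `(i, e)` and `(e, i)`, this bounds `θ i` on both sides, as `θ e = 0`.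
  have hlow : ∀ q ∈ (Finset.univ : Finset (Fin m)).offDiag, ∃ B : ℝ, 0 ≤ B ∧
      ∀ d, b ≤ K q / 2 * w * Real.log (pairCdf ν q.1 q.2 d) → -B ≤ d := by
    intro q hq
    have hq' := (Finset.mem_offDiag.1 hq).2.2
    have h1 : Tendsto (fun d => Real.log (pairCdf ν q.1 q.2 d)) atBot atBot :=
      Real.tendsto_log_nhdsGT_zero.comp (tendsto_nhdsWithin_iff.2
        ⟨tendsto_pairCdf_atBot ν q.1 q.2, Eventually.of_forall fun d => pairCdf_pos ν hq' d⟩)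
    have h2 : Tendsto (fun d => K q / 2 * w * Real.log (pairCdf ν q.1 q.2 d)) atBot atBot :=
      h1.const_mul_atBot (mul_pos (half_pos (hKpos q hq)) hw)
    obtain ⟨B, hB⟩ := (h2.eventually_lt_atBot b).exists_forall_of_atBot
    refine ⟨max (-B) 0, le_max_right _ _, fun d hd => ?_⟩
    by_contra hn
    have : d ≤ B := by
      have := le_max_left (-B) 0
      linarith
    linarith [hB d this]
  choose! B hB0 hB using hlow
  have hAcompact : IsCompact A := by
    refine Metric.isCompact_of_isClosed_isBounded hAclosed ?_
    refine isBounded_iff_forall_norm_le.2 ⟨∑ q ∈ (Finset.univ : Finset (Fin m)).offDiag, B q, ?_⟩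
    rintro θ ⟨hθ, hθA⟩
    have hsum0 := Finset.sum_nonneg hB0
    refine (pi_norm_le_iff_of_nonneg hsum0).2 fun i => ?_
    have hθe := hθ e he
    by_cases hie : i = e
    · rw [hie, hθe, norm_zero]
      exact hsum0
    · have hm1 : (i, e) ∈ (Finset.univ : Finset (Fin m)).offDiag := by simp [hie]
      have hm2 : (e, i) ∈ (Finset.univ : Finset (Fin m)).offDiag := by simp [Ne.symm hie]
      have h1 := hB _ hm1 _ (hθA _ hm1)
      have h2 := hB _ hm2 _ (hθA _ hm2)
      have h3 := Finset.single_le_sum hB0 hm1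
      have h4 := Finset.single_le_sum hB0 hm2
      simp only [hθe] at h1 h2
      rw [Real.norm_eq_abs, abs_le]
      constructor <;> linarith
  have hcont := continuous_compLik ν w
  have hcontκ : ∀ κ, Continuous (compLik ν w κ) := fun κ =>
    hcont.comp (continuous_const.prodMk continuous_id)
  have hev1 : ∀ᶠ κ in 𝓝 K, b < compLik ν w κ θ₀ :=
    (hcont.comp (continuous_id.prodMk continuous_const)).continuousAt.eventually_const_lt
      (show b < compLik ν w K θ₀ by linarith)
  have hev2 : ∀ᶠ κ in 𝓝 K, ∀ q ∈ (Finset.univ : Finset (Fin m)).offDiag, K q / 2 < κ q :=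
    (Finset.eventually_all _).2 fun q hq => (continuous_apply q).continuousAt.eventually_const_lt
      (half_lt_self (hKpos q hq))
  have hev3 : ∀ᶠ κ in 𝓝 K, ∀ θ ∈ A ∩ {θ | ε ≤ dist θ θ₀}, compLik ν w κ θ < compLik ν w κ θ₀ := by
    refine (hAcompact.inter_right (isClosed_le continuous_const (by fun_prop))
      ).eventually_forall_of_forall_eventually fun θ hθ => ?_
    have hne : ∃ i j, i ≠ j ∧ θ i - θ j ≠ θ₀ i - θ₀ j := by
      by_contra! hcon
      have : θ = θ₀ := by
        funext i
        by_cases hie : i = e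
        · rw [hie, hθ.1.1 e he, hθ₀ e he]
        · have := hcon i e hie
          rwa [hθ.1.1 e he, hθ₀ e he, sub_zero, sub_zero] at this
      have h2 : ε ≤ dist θ θ₀ := hθ.2
      rw [this, dist_self] at h2
      linarith
    exact hcont.continuousAt.eventually_lt
      ((hcont.comp (continuous_fst.prodMk continuous_const)).continuousAt)
      (compLik_lt_of_ne ν hc hw hne)
  filter_upwards [hev1, hev2, hev3] with κ h1 h2 h3
  -- All summands are nonpositive, so each is at least the whole sum, which exceeds `b`; replacing
  -- `κ q` by the smaller `K q / 2` only increases it.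
  have hmemA : ∀ θ ∈ paramSpace m, compLik ν w κ θ₀ ≤ compLik ν w κ θ → θ ∈ A := by
    intro θ hθ hle
    refine ⟨hθ, fun q hq => ?_⟩
    have hterm : ∀ q ∈ (Finset.univ : Finset (Fin m)).offDiag,
        κ q * w * Real.log (pairCdf ν q.1 q.2 (θ q.1 - θ q.2)) ≤ 0 := fun q hq =>
      mul_nonpos_of_nonneg_of_nonpos
        (mul_nonneg ((half_pos (hKpos q hq)).trans (h2 q hq)).le hw.le) (log_pairCdf_nonpos ν _ _ _)
    have h4 : compLik ν w κ θ ≤ κ q * w * Real.log (pairCdf ν q.1 q.2 (θ q.1 - θ q.2)) := by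
      rw [compLik, ← Finset.add_sum_erase _ _ hq]
      have := Finset.sum_nonpos (s := (Finset.univ : Finset (Fin m)).offDiag.erase q)
        fun q' hq' => hterm q' (Finset.mem_of_mem_erase hq')
      linarith
    have h5 : κ q * w * Real.log (pairCdf ν q.1 q.2 (θ q.1 - θ q.2)) ≤
        K q / 2 * w * Real.log (pairCdf ν q.1 q.2 (θ q.1 - θ q.2)) :=
      mul_le_mul_of_nonpos_right (mul_le_mul_of_nonneg_right (h2 q hq).le hw.le)
        (log_pairCdf_nonpos ν _ _ _)
    linarith
  have hθ₀A := hmemA θ₀ hθ₀ le_rfl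
  constructor
  · obtain ⟨θ, hθA, hθmax⟩ := hAcompact.exists_isMaxOn ⟨θ₀, hθ₀A⟩ (hcontκ κ).continuousOn
    refine ⟨θ, hθA.1, fun θ' hθ' => ?_⟩
    by_cases h : compLik ν w κ θ₀ ≤ compLik ν w κ θ'
    · exact hθmax (hmemA θ' hθ' h)
    · exact (not_le.1 h).le.trans (hθmax hθ₀A)
  · intro θ hθ hmax
    by_contra hn
    exact absurd (h3 θ ⟨hmemA θ hθ (hmax hθ₀), not_lt.1 hn⟩) (not_lt.2 (hmax hθ₀))

end Objective

/-! ### Consistency and the expected objective -/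

section Consistency

variable {m : ℕ} {π : Fin m → ℝ → ℝ}

theorem mem_rbcml_iff (hπ : ∀ i, IsUtilityDensity (π i)) (G : Breaking m)
    {W : CMLWeight m} {w : ℝ} (hW : ∀ i j, i ≠ j → W.weight i j = w) {n : ℕ} (P : Profile m n)
    (θ : Fin m → ℝ) :
    θ ∈ rbcml π G W P ↔ θ ∈ paramSpace m ∧ IsMaxOn (compLik (fun i => shapeLaw (π i)) w
      fun q => (∑ t, G.extract (P t) q.1 q.2) / n) (paramSpace m) θ := by
  have h : cll π G W P = compLik (fun i => shapeLaw (π i)) w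
      fun q => (∑ t, G.extract (P t) q.1 q.2) / n := funext fun θ => cll_eq_compLik hπ G hW P θ
  rw [← h]
  rfl

theorem rbcmlConsistent_of_isUniform (hπ : ∀ i, IsUtilityDensity (π i)) {G : Breaking m}
    (hG : G.IsNonempty) (hu : G.IsUniform) {W : CMLWeight m} (hW : W.IsUniform) :
    RBCMLConsistent π G W := by
  obtain ⟨k, l, hkl, hpos⟩ := hG
  obtain ⟨c, hc⟩ := hu
  obtain ⟨w, hw, hW⟩ := hW
  rw [hc k l hkl] at hpos
  have hm : 0 < m := k.pos
  have : ∀ i, IsProbabilityMeasure (shapeLaw (π i)) := fun i => (hπ i).isProbabilityMeasure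
  have : ∀ i, (shapeLaw (π i)).IsOpenPosMeasure := fun i => (hπ i).isOpenPosMeasure
  have : ∀ i, NullSingletonClass (shapeLaw (π i)) := fun i => nullSingletonClass_shapeLaw _
  set ν : Fin m → Measure ℝ := fun i => shapeLaw (π i) with hν
  intro θ₀ hθ₀ ε hε
  -- With constant weight the extracted weight is `c` times the indicator of winning.
  have hmean : (fun q : Fin m × Fin m => ∑ R, rankingProb π θ₀ R * G.extract R q.1 q.2) =
      fun q => c * pairCdf ν q.1 q.2 (θ₀ q.1 - θ₀ q.2) := by
    classical
    funext q
    rw [sum_rankingProb_mul hπ θ₀ (fun R => G.extract R q.1 q.2)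
      (fun u => {u : Fin m → ℝ | u q.2 < u q.1}.indicator (fun _ => c) u), ← pairProb_eq_pairCdf hπ,
      pairProb, utilityLaw_real hπ _ (measurableSet_lt (by fun_prop) (by fun_prop)), mul_comm,
      ← smul_eq_mul, ← integral_indicator_const]
    · rfl
    · exact (by fun_prop : Measurable fun (x : Fin m → ℝ) i => x i + θ₀ i)
        (measurableSet_lt (measurable_pi_apply q.2) (measurable_pi_apply q.1))
    · intro u R hR
      by_cases h : u q.2 < u q.1
      · have h' := (symm_lt_symm_iff hR q.1 q.2).2 h
        rw [Set.indicator_of_mem (show u ∈ {u : Fin m → ℝ | u q.2 < u q.1} from h),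
          Breaking.extract, if_pos h', hc _ _ h'.ne]
      · rw [Set.indicator_of_notMem (show u ∉ {u : Fin m → ℝ | u q.2 < u q.1} from h),
          Breaking.extract, if_neg fun h' => h ((symm_lt_symm_iff hR q.1 q.2).1 h')]
  have hev := eventually_argmax_compLik ν (e := ⟨m - 1, by omega⟩) (by simp; omega) hpos hw hθ₀ hε
  rw [← hmean] at hev
  have hlln := tendsto_iidProb_mean_mem (rankingProb_nonneg θ₀) (sum_rankingProb hπ θ₀)
    (fun R (q : Fin m × Fin m) => G.extract R q.1 q.2) hev
  refine tendsto_of_tendsto_of_tendsto_of_le_of_le hlln tendsto_const_nhds (fun n => ?_)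
    fun n => iidProb_le_one (rankingProb_nonneg θ₀) (sum_rankingProb hπ θ₀) _
  refine iidProb_mono (rankingProb_nonneg θ₀) ?_
  rintro P ⟨⟨θ, hθ, hmax⟩, hall⟩
  refine ⟨⟨θ, (mem_rbcml_iff hπ G hW P θ).2 ⟨hθ, hmax⟩⟩, fun θ' hθ' => ?_⟩
  obtain ⟨h1, h2⟩ := (mem_rbcml_iff hπ G hW P θ').1 hθ'
  exact hall θ' h1 h2

/-- Consistency forces every parameter to maximize the expected composite likelihood under the
model with this parameter. -/
theorem RBCMLConsistent.compLik_le (hπ : ∀ i, IsUtilityDensity (π i)) {G : Breaking m}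
    {W : CMLWeight m} {w : ℝ} (hW : ∀ i j, i ≠ j → W.weight i j = w)
    (hcons : RBCMLConsistent π G W) (θ₀ θ : Fin m → ℝ) :
    compLik (fun i => shapeLaw (π i)) w
        (fun q => meanReward (fun i => shapeLaw (π i)) G.weight θ₀ q.1 q.2) θ ≤
      compLik (fun i => shapeLaw (π i)) w
        (fun q => meanReward (fun i => shapeLaw (π i)) G.weight θ₀ q.1 q.2) θ₀ := by
  have : ∀ i, IsProbabilityMeasure (shapeLaw (π i)) := fun i => (hπ i).isProbabilityMeasure
  have : ∀ i, (shapeLaw (π i)).IsOpenPosMeasure := fun i => (hπ i).isOpenPosMeasure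
  have : ∀ i, NullSingletonClass (shapeLaw (π i)) := fun i => nullSingletonClass_shapeLaw _
  set ν : Fin m → Measure ℝ := fun i => shapeLaw (π i) with hν
  have hnorm : ∀ θ : Fin m → ℝ, ∃ θ' ∈ paramSpace m, ∀ i j, θ i - θ j = θ' i - θ' j := by
    intro θ
    rcases Nat.eq_zero_or_pos m with h0 | hm
    · subst h0
      exact ⟨θ, fun i => i.elim0, fun i => i.elim0⟩
    · refine ⟨fun i => θ i - θ ⟨m - 1, by omega⟩, fun i hi => ?_, fun i j => by ring⟩
      have : i = ⟨m - 1, by omega⟩ := Fin.ext (by simp; omega)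
      rw [← this]
      exact sub_self _
  obtain ⟨θ', hθ', h'⟩ := hnorm θ
  obtain ⟨θ₁, hθ₁, h₁⟩ := hnorm θ₀
  have hmr : (fun q : Fin m × Fin m => meanReward ν G.weight θ₀ q.1 q.2) =
      fun q => meanReward ν G.weight θ₁ q.1 q.2 :=
    funext fun q => meanReward_congr_sub ν G.weight h₁ q.1 q.2
  rw [compLik_congr_sub ν w _ h', compLik_congr_sub ν w _ h₁, hmr]
  set K : Fin m × Fin m → ℝ := fun q => meanReward ν G.weight θ₁ q.1 q.2 with hK
  -- A strictly better `θ'` would, by continuity, beat every parameter near `θ₁` for all weights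
  -- near `K`. Some profile has such weights and a maximizer near `θ₁`, a contradiction.
  by_contra! hlt
  have hcont := continuous_compLik ν w
  have hev : ∀ᶠ z in 𝓝 (K, θ₁), compLik ν w z.1 z.2 < compLik ν w z.1 θ' :=
    hcont.continuousAt.eventually_lt
      (hcont.comp (continuous_fst.prodMk continuous_const)).continuousAt hlt
  rw [nhds_prod_eq] at hev
  obtain ⟨pa, hpa, pb, hpb, hab⟩ := eventually_prod_iff.1 hev
  obtain ⟨ε, hε, hball⟩ := Metric.eventually_nhds_iff.1 hpb
  have hmean : (fun q : Fin m × Fin m => ∑ R, rankingProb π θ₁ R * G.extract R q.1 q.2) = K :=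
    funext fun q => sum_rankingProb_mul_extract hπ G θ₁ q.1 q.2
  rw [← hmean] at hpa
  have hlln := tendsto_iidProb_mean_mem (rankingProb_nonneg θ₁) (sum_rankingProb hπ θ₁)
    (fun R (q : Fin m × Fin m) => G.extract R q.1 q.2) hpa
  obtain ⟨n, P, hP1, ⟨θ₂, hθ₂⟩, hP3⟩ := exists_mem_of_tendsto_iidProb (rankingProb_nonneg θ₁)
    (sum_rankingProb hπ θ₁) hlln (hcons θ₁ hθ₁ ε hε)
  have h2 := hab hP1 (hball (hP3 θ₂ hθ₂))
  obtain ⟨-, hmax⟩ := (mem_rbcml_iff hπ G hW P θ₂).1 hθ₂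
  exact absurd h2 (not_lt.2 (hmax hθ'))

end Consistency

/-! ### The stationarity equation -/

section FirstOrder

variable {m : ℕ} (ν : Fin m → Measure ℝ) [∀ i, IsProbabilityMeasure (ν i)]
  [∀ i, (ν i).IsOpenPosMeasure] [∀ i, NullSingletonClass (ν i)]

/-- The stationarity equation in the location of `a` at `θ` for the weights `g`, where `φ j` is the
derivative of the probability that `a` beats `j`. -/
def StationaryAt (φ : Fin m → ℝ → ℝ) (a : Fin m) (g : Fin m → Fin m → ℝ) (θ : Fin m → ℝ) : Prop :=
  ∑ j ∈ Finset.univ.erase a, φ j (θ a - θ j) *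
    (meanReward ν g θ a j / pairCdf ν a j (θ a - θ j) -
      meanReward ν g θ j a / pairCdf ν j a (θ j - θ a)) = 0

theorem stationaryAt_of_isMax {φ : Fin m → ℝ → ℝ} {a : Fin m}
    (hφ : ∀ j, j ≠ a → ∀ d, HasDerivAt (pairCdf ν a j) (φ j d) d) {w : ℝ} (hw : 0 < w)
    {g : Fin m → Fin m → ℝ} {θ : Fin m → ℝ}
    (hmax : ∀ θ', compLik ν w (fun q => meanReward ν g θ q.1 q.2) θ' ≤
      compLik ν w (fun q => meanReward ν g θ q.1 q.2) θ) :
    StationaryAt ν φ a g θ := by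
  classical
  have hφ' : ∀ j, j ≠ a → ∀ d, HasDerivAt (pairCdf ν j a) (φ j (-d)) d := by
    intro j hj d
    have h1 : pairCdf ν j a = fun d => 1 - pairCdf ν a j (-d) := by
      funext d
      have := pairCdf_add_swap ν hj d
      linarith
    rw [h1]
    have := ((hφ j hj (-d)).comp d (hasDerivAt_neg d)).const_sub 1
    simpa using this
  set K : Fin m × Fin m → ℝ := fun q => meanReward ν g θ q.1 q.2 with hK
  -- Only pairs containing `a` depend on its location; the sign is negative when `a` is the loser.
  let D : Fin m × Fin m → ℝ := fun q =>
    (if q.1 = a then K (a, q.2) * w * (φ q.2 (θ a - θ q.2) / pairCdf ν a q.2 (θ a - θ q.2)) else 0) -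
      if q.2 = a then K (q.1, a) * w * (φ q.1 (θ a - θ q.1) / pairCdf ν q.1 a (θ q.1 - θ a)) else 0
  have hder : HasDerivAt (fun t => compLik ν w K (Function.update θ a t))
      (∑ q ∈ (Finset.univ : Finset (Fin m)).offDiag, D q) (θ a) := by
    refine HasDerivAt.fun_sum fun q hq => ?_
    obtain ⟨i, j⟩ := q
    have hij : i ≠ j := (Finset.mem_offDiag.1 hq).2.2
    by_cases hi : i = a
    · subst hi
      have hji : j ≠ i := hij.symm
      simp only [D, if_true, if_neg hji, sub_zero, Function.update_self,
        Function.update_of_ne hji]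
      refine HasDerivAt.const_mul _ (HasDerivAt.log ?_ (pairCdf_pos ν hij _).ne')
      simpa using (hφ j hji (θ i - θ j)).comp_sub_const (θ i) (θ j)
    · by_cases hj : j = a
      · subst hj
        simp only [D, if_true, if_neg hij, zero_sub, Function.update_self,
          Function.update_of_ne hij]
        rw [← mul_neg, ← neg_div]
        refine HasDerivAt.const_mul _ (HasDerivAt.log ?_ (pairCdf_pos ν hij _).ne')
        have := (hφ' i hij (θ i - θ j)).comp_const_sub (θ i) (θ j)
        simpa using this
      · simp only [D, if_neg hi, if_neg hj, sub_zero, Function.update_of_ne hi,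
          Function.update_of_ne hj]
        exact hasDerivAt_const _ _
  have hloc : IsLocalMax (fun t => compLik ν w K (Function.update θ a t)) (θ a) :=
    Eventually.of_forall fun t => by
      simp only [Function.update_eq_self]
      exact hmax _
  have h0 := hloc.hasDerivAt_eq_zero hder
  have hsum : ∑ q ∈ (Finset.univ : Finset (Fin m)).offDiag, D q =
      w * ∑ j ∈ Finset.univ.erase a, φ j (θ a - θ j) *
        (K (a, j) / pairCdf ν a j (θ a - θ j) - K (j, a) / pairCdf ν j a (θ j - θ a)) := by
    simp only [D]
    rw [Finset.sum_sub_distrib, ← Finset.sum_filter, ← Finset.sum_filter, Finset.mul_sum]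
    have e1 : ((Finset.univ : Finset (Fin m)).offDiag.filter fun q => q.1 = a) =
        (Finset.univ.erase a).map ⟨fun j => (a, j), fun _ _ h => (Prod.ext_iff.1 h).2⟩ := by
      ext ⟨i, j⟩
      simp only [Finset.mem_filter, Finset.mem_offDiag, Finset.mem_univ, true_and, Finset.mem_map,
        Finset.mem_erase]
      constructor
      · rintro ⟨h, rfl⟩
        exact ⟨j, ⟨Ne.symm h, trivial⟩, rfl⟩
      · rintro ⟨j', ⟨h, -⟩, h2⟩
        obtain ⟨rfl, rfl⟩ := Prod.ext_iff.1 h2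
        exact ⟨Ne.symm h, rfl⟩
    have e2 : ((Finset.univ : Finset (Fin m)).offDiag.filter fun q => q.2 = a) =
        (Finset.univ.erase a).map ⟨fun j => (j, a), fun _ _ h => (Prod.ext_iff.1 h).1⟩ := by
      ext ⟨i, j⟩
      simp only [Finset.mem_filter, Finset.mem_offDiag, Finset.mem_univ, true_and, Finset.mem_map,
        Finset.mem_erase]
      constructor
      · rintro ⟨h, rfl⟩
        exact ⟨i, ⟨h, trivial⟩, rfl⟩
      · rintro ⟨j', ⟨h, -⟩, h2⟩
        obtain ⟨rfl, rfl⟩ := Prod.ext_iff.1 h2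
        exact ⟨h, rfl⟩
    rw [e1, e2, Finset.sum_map, Finset.sum_map, ← Finset.sum_sub_distrib]
    refine Finset.sum_congr rfl fun j _ => ?_
    change K (a, j) * w * (φ j (θ a - θ j) / pairCdf ν a j (θ a - θ j)) -
      K (j, a) * w * (φ j (θ a - θ j) / pairCdf ν j a (θ j - θ a)) = _
    ring
  rw [hsum] at h0
  exact (mul_eq_zero.1 h0).resolve_left hw.ne'

end FirstOrder

/-! ### Light-tailed densities -/

section LightTail

variable {f : ℝ → ℝ}

/-- An even positive density whose logarithmic derivative is nonincreasing and tends to `∞` at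
`-∞`. -/
structure IsLightTailed (f : ℝ → ℝ) : Prop extends IsUtilityDensity f where
  even : ∀ x, f (-x) = f x
  differentiable : Differentiable ℝ f
  antitone : Antitone (deriv fun x => Real.log (f x))
  tendsto : Tendsto (deriv fun x => Real.log (f x)) atBot atTop

theorem IsLightTailed.differentiable_log (hf : IsLightTailed f) :
    Differentiable ℝ fun x => Real.log (f x) :=
  hf.differentiable.log fun x => (hf.pos x).ne'

theorem IsLightTailed.deriv_log_nonneg (hf : IsLightTailed f) {x : ℝ} (hx : x ≤ 0) :
    0 ≤ deriv (fun x => Real.log (f x)) x := by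
  -- Evenness makes the logarithmic derivative vanish at `0`; antitonicity does the rest.
  have h := deriv_comp_neg (fun x => Real.log (f x)) 0
  simp only [hf.even, neg_zero] at h
  have := hf.antitone hx
  linarith

theorem IsLightTailed.le_zero (hf : IsLightTailed f) (x : ℝ) : f x ≤ f 0 := by
  wlog hx : x ≤ 0 generalizing x
  · rw [← hf.even]
    exact this (-x) (by linarith)
  have hmono : MonotoneOn (fun x => Real.log (f x)) (Set.Iic 0) :=
    monotoneOn_of_deriv_nonneg (convex_Iic 0) hf.differentiable_log.continuous.continuousOn
      hf.differentiable_log.differentiableOn fun y hy => by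
        rw [interior_Iic] at hy
        exact hf.deriv_log_nonneg (le_of_lt hy)
  exact (Real.log_le_log_iff (hf.pos x) (hf.pos 0)).1 (hmono hx (Set.mem_Iic.2 le_rfl) hx)

theorem IsLightTailed.exists_mul_sub_le (hf : IsLightTailed f) (C : ℝ) :
    ∃ Z, ∀ x y, x ≤ y → y ≤ Z → C * (y - x) ≤ Real.log (f y) - Real.log (f x) := by
  obtain ⟨Z, hZ⟩ := (hf.tendsto.eventually_ge_atTop C).exists_forall_of_atBot
  refine ⟨Z, fun x y hxy hy => ?_⟩
  refine (convex_Iic Z).mul_sub_le_image_sub_of_le_deriv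
    hf.differentiable_log.continuous.continuousOn hf.differentiable_log.differentiableOn
    (fun z hz => ?_) x (Set.mem_Iic.2 (hxy.trans hy)) y (Set.mem_Iic.2 hy) hxy
  rw [interior_Iic] at hz
  exact hZ z (le_of_lt hz)

theorem IsLightTailed.tendsto_atBot (hf : IsLightTailed f) : Tendsto f atBot (𝓝 0) := by
  obtain ⟨Z, hZ⟩ := hf.exists_mul_sub_le 1
  have h1 : Tendsto (fun x => Real.log (f x)) atBot atBot := by
    refine tendsto_atBot_mono' _ (f₁ := fun x => x + (Real.log (f Z) - Z)) ?_
      (tendsto_atBot_add_const_right _ _ tendsto_id)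
    filter_upwards [eventually_le_atBot Z] with x hx
    linarith [hZ x Z hx le_rfl]
  refine (Real.tendsto_exp_atBot.comp h1).congr fun x => ?_
  exact Real.exp_log (hf.pos x)

theorem IsLightTailed.tendsto_atTop (hf : IsLightTailed f) : Tendsto f atTop (𝓝 0) :=
  (hf.tendsto_atBot.comp tendsto_neg_atTop_atBot).congr hf.even

/-- The distribution function grows faster than any exponential at `-∞`. -/
theorem IsLightTailed.exists_Iio_le (hf : IsLightTailed f) {η : ℝ} (hη : 0 < η) :
    ∃ Z, ∀ z ≤ Z, (shapeLaw f).real (Set.Iio z) ≤ η * (shapeLaw f).real (Set.Iio (z + 1)) := by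
  have := hf.isProbabilityMeasure
  -- Slope `-log η` of `log f` gives `f x ≤ η * f (x + 1)`; the threshold `Z - 1` keeps `x + 1`
  -- below `Z`.
  obtain ⟨Z, hZ⟩ := hf.exists_mul_sub_le (-Real.log η)
  refine ⟨Z - 1, fun z hz => ?_⟩
  have hle : ∀ x < z, f x ≤ η * f (x + 1) := by
    intro x hx
    have h := hZ x (x + 1) (by linarith) (by linarith)
    rw [← Real.log_le_log_iff (hf.pos x) (mul_pos hη (hf.pos _)),
      Real.log_mul hη.ne' (hf.pos _).ne']
    linarith
  have hshift : shapeLaw f (Set.Iio (z + 1)) = shapeLaw (fun x => f (x - -1)) (Set.Iio z) := by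
    rw [← map_add_shapeLaw, Measure.map_apply (by fun_prop) measurableSet_Iio]
    congr 1
    ext x
    simp only [Set.mem_Iio, Set.mem_preimage]
    constructor <;> intro h <;> linarith
  have hmain : shapeLaw f (Set.Iio z) ≤ ENNReal.ofReal η * shapeLaw f (Set.Iio (z + 1)) := by
    have hm : Measurable fun x => ENNReal.ofReal (f (x - -1)) :=
      (hf.continuous.measurable.comp (measurable_id.sub_const _)).ennreal_ofReal
    rw [hshift, shapeLaw, shapeLaw, withDensity_apply _ measurableSet_Iio,
      withDensity_apply _ measurableSet_Iio, ← lintegral_const_mul _ hm]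
    refine setLIntegral_mono (hm.const_mul _) fun x hx => ?_
    rw [← ENNReal.ofReal_mul hη.le, sub_neg_eq_add]
    exact ENNReal.ofReal_le_ofReal (hle x hx)
  have := ENNReal.toReal_mono (ENNReal.mul_ne_top ENNReal.ofReal_ne_top (measure_ne_top _ _)) hmain
  rwa [ENNReal.toReal_mul, ENNReal.toReal_ofReal hη.le] at this

theorem IsUtilityDensity.hasDerivAt_real_Ioi (hf : IsUtilityDensity f) (x : ℝ) :
    HasDerivAt (fun x => (shapeLaw f).real (Set.Ioi x)) (-f x) x := by
  have := hf.isProbabilityMeasure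
  have h1 : ∀ x, (shapeLaw f).real (Set.Ioi x) =
      1 - (∫ y in Set.Iic 0, f y) - ∫ y in (0 : ℝ)..x, f y := by
    intro x
    have h2 : (shapeLaw f).real (Set.Iic x) = ∫ y in Set.Iic x, f y := by
      rw [measureReal_def, shapeLaw, withDensity_apply _ measurableSet_Iic,
        integral_eq_lintegral_of_nonneg_ae (Eventually.of_forall fun y => (hf.pos y).le)
          hf.continuous.aestronglyMeasurable]
    rw [← intervalIntegral.integral_Iic_sub_Iic hf.integrable.integrableOn
      hf.integrable.integrableOn, ← h2, ← Set.compl_Iic, probReal_compl_eq_one_sub measurableSet_Iic]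
    ring
  simp only [h1]
  exact (intervalIntegral.integral_hasDerivAt_right (hf.continuous.intervalIntegrable _ _)
    (hf.continuous.stronglyMeasurableAtFilter _ _) hf.continuous.continuousAt).const_sub _

end LightTail

/-! ### Comparisons involving the light-tailed alternative -/

section Special

variable {m : ℕ} {π : Fin m → ℝ → ℝ}

/-- The density at `-d` of the difference of the noise of `a` and of `j`. -/
def diffDensity (π : Fin m → ℝ → ℝ) (a j : Fin m) (d : ℝ) : ℝ := ∫ y, π a (y - d) ∂shapeLaw (π j)

variable (hπ : ∀ i, IsUtilityDensity (π i)) {a j : Fin m} (ha : IsLightTailed (π a))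

include ha in
theorem norm_light_le (x : ℝ) : ‖π a x‖ ≤ π a 0 := by
  rw [Real.norm_of_nonneg (ha.pos x).le]
  exact ha.le_zero x

include ha in
theorem continuous_light_sub (d : ℝ) : Continuous fun y => π a (y - d) :=
  ha.continuous.comp (by fun_prop)

include hπ ha in
theorem integrable_light_sub (d : ℝ) : Integrable (fun y => π a (y - d)) (shapeLaw (π j)) := by
  have := (hπ j).isProbabilityMeasure
  exact Integrable.of_bound (continuous_light_sub ha d).aestronglyMeasurable
    (π a 0) (Eventually.of_forall fun y => norm_light_le ha _)

include hπ ha in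
theorem diffDensity_pos (d : ℝ) : 0 < diffDensity π a j d := by
  have := (hπ j).isProbabilityMeasure
  refine (integral_pos_iff_support_of_nonneg (fun y => (ha.pos _).le)
    (integrable_light_sub hπ ha d)).2 ?_
  have : (Function.support fun y => π a (y - d)) = Set.univ :=
    Set.eq_univ_of_forall fun y => (ha.pos (y - d)).ne'
  rw [this, measure_univ]
  exact one_pos

include hπ ha in
theorem tendsto_diffDensity {l : Filter ℝ} [l.IsCountablyGenerated]
    (hl : ∀ y, Tendsto (fun d => π a (y - d)) l (𝓝 0)) :
    Tendsto (diffDensity π a j) l (𝓝 0) := by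
  have := (hπ j).isProbabilityMeasure
  rw [show (0 : ℝ) = ∫ _y, (0 : ℝ) ∂shapeLaw (π j) by simp]
  exact tendsto_integral_filter_of_dominated_convergence (fun _ => π a 0)
    (Eventually.of_forall fun d =>
      (continuous_light_sub ha d).aestronglyMeasurable)
    (Eventually.of_forall fun d => Eventually.of_forall fun y => norm_light_le ha _)
    (integrable_const _) (Eventually.of_forall hl)

include hπ ha in
theorem tendsto_diffDensity_atTop : Tendsto (diffDensity π a j) atTop (𝓝 0) :=
  tendsto_diffDensity hπ ha fun y => ha.tendsto_atBot.comp
    (tendsto_atBot_add_const_left _ y tendsto_neg_atTop_atBot)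

include hπ ha in
theorem tendsto_diffDensity_atBot : Tendsto (diffDensity π a j) atBot (𝓝 0) :=
  tendsto_diffDensity hπ ha fun y => ha.tendsto_atTop.comp
    (tendsto_atTop_add_const_left _ y tendsto_neg_atBot_atTop)

include hπ ha in
-- Condition on the noise of `j` and differentiate under the integral; the mode value `π a 0`
-- dominates.
theorem hasDerivAt_pairCdf (hj : j ≠ a) (d : ℝ) :
    HasDerivAt (pairCdf (fun i => shapeLaw (π i)) a j) (diffDensity π a j d) d := by
  have : ∀ i, IsProbabilityMeasure (shapeLaw (π i)) := fun i => (hπ i).isProbabilityMeasure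
  have h : pairCdf (fun i => shapeLaw (π i)) a j =
      fun d => ∫ y, (shapeLaw (π a)).real (Set.Ioi (y - d)) ∂shapeLaw (π j) :=
    funext fun d => pairCdf_eq_integral (fun i => shapeLaw (π i)) hj.symm d
  have hanti : Antitone fun x => (shapeLaw (π a)).real (Set.Ioi x) := fun x y hxy =>
    measureReal_mono (Set.Ioi_subset_Ioi hxy)
  rw [h]
  refine (hasDerivAt_integral_of_dominated_loc_of_deriv_le (s := Set.univ)
    (bound := fun _ => π a 0) (F := fun d y => (shapeLaw (π a)).real (Set.Ioi (y - d)))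
    (F' := fun d y => π a (y - d)) univ_mem
    (Eventually.of_forall fun d => ?_) ?_ ?_ ?_ (integrable_const _) ?_).2
  · exact (hanti.measurable.comp (measurable_id.sub_const d)).aestronglyMeasurable
  · refine Integrable.of_bound
      (hanti.measurable.comp (measurable_id.sub_const d)).aestronglyMeasurable 1
      (Eventually.of_forall fun y => ?_)
    rw [Real.norm_of_nonneg measureReal_nonneg]
    exact measureReal_le_one
  · exact (continuous_light_sub ha d).aestronglyMeasurable
  · exact Eventually.of_forall fun y x _ => norm_light_le ha _
  · refine Eventually.of_forall fun y x _ => ?_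
    simpa using (ha.hasDerivAt_real_Ioi (y - x)).comp_const_sub y x

include hπ ha in
/-- If `a` is far ahead but still loses to `j`, then it almost surely beats any third
alternative. -/
theorem exists_lose_both_le {c : Fin m} (hja : j ≠ a) (hca : c ≠ a) (hcj : c ≠ j) {η : ℝ}
    (hη : 0 < η) :
    ∀ᶠ t in atTop, (Measure.pi fun i => shapeLaw (π i)).real {x | x a + t < x j ∧ x a + t < x c} ≤
      η * pairCdf (fun i => shapeLaw (π i)) j a (-t) := by
  have : ∀ i, IsProbabilityMeasure (shapeLaw (π i)) := fun i => (hπ i).isProbabilityMeasure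
  have : ∀ i, (shapeLaw (π i)).IsOpenPosMeasure := fun i => (hπ i).isOpenPosMeasure
  set μ := Measure.pi fun i => shapeLaw (π i) with hμ
  have hind := ProbabilityTheory.iIndepFun_pi (μ := fun i => shapeLaw (π i)) (X := fun _ => id)
    (fun i => aemeasurable_id)
  have heval : ∀ (i : Fin m) {s : Set ℝ}, MeasurableSet s →
      μ.real {x | x i ∈ s} = (shapeLaw (π i)).real s := fun i s hs => by
    rw [measureReal_def, measureReal_def, 
      ← (measurePreserving_eval (fun i => shapeLaw (π i)) i).measure_preimage hs.nullMeasurableSet]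
    rfl
  -- Split by `x c`. The event `M ≤ x c` is rare and independent of `a` losing to `j`. If `x c < M`,
  -- then losing to `c` forces `x a + t < M`, which the light tail makes rare compared with losing
  -- to `j`.
  obtain ⟨M, hM⟩ : ∃ M, (shapeLaw (π c)).real (Set.Ici M) ≤ η / 2 := by
    have h := tendsto_measure_of_ae_tendsto_indicator_of_isFiniteMeasure (μ := shapeLaw (π c))
      atTop (A := ∅) (As := fun M : ℝ => Set.Ici M) MeasurableSet.empty
      (fun M => measurableSet_Ici) (Eventually.of_forall fun x => by
        filter_upwards [eventually_gt_atTop x] with M hM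
        exact iff_of_false (not_le.2 hM) (Set.notMem_empty x))
    rw [measure_empty] at h
    exact (((ENNReal.tendsto_toReal ENNReal.zero_ne_top).comp h).eventually_le_const
      (half_pos hη)).exists
  set q := (shapeLaw (π j)).real (Set.Ici (M + 1)) with hq
  have hqpos : 0 < q := by
    refine lt_of_lt_of_le (ENNReal.toReal_pos (isOpen_Ioi.measure_ne_zero (shapeLaw (π j))
      (Set.nonempty_Ioi (a := M + 1))) (measure_ne_top _ _)) ?_
    exact measureReal_mono Set.Ioi_subset_Ici_self
  obtain ⟨Z, hZ⟩ := ha.exists_Iio_le (η := η / 2 * q) (by positivity)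
  filter_upwards [eventually_ge_atTop (M - Z)] with t ht
  have hmE : MeasurableSet {p : ℝ × ℝ | p.1 + t < p.2} :=
    measurableSet_lt (by fun_prop) (by fun_prop)
  have hE : pairCdf (fun i => shapeLaw (π i)) j a (-t) = μ.real {x | x a + t < x j} := by
    rw [pairCdf]
    congr 1
    ext x
    change x a < x j + -t ↔ x a + t < x j
    exact lt_add_neg_iff_add_lt
  have h1 : μ.real {x | x a + t < M} ≤ η / 2 * μ.real {x | x a + t < x j} := by
    have e1 : μ.real {x | x a + t < M} = (shapeLaw (π a)).real (Set.Iio (M - t)) := by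
      rw [← heval a measurableSet_Iio]
      congr 1
      ext x
      change x a + t < M ↔ x a < M - t
      exact lt_sub_iff_add_lt.symm
    -- One sufficient way for `a` to lose: `x a + t < M + 1 ≤ x j`. The extra unit is the one gained
    -- in `exists_Iio_le`.
    have e2 : (shapeLaw (π a)).real (Set.Iio (M - t + 1)) * q ≤ μ.real {x | x a + t < x j} := by
      have h3 := (hind.indepFun hja.symm).measure_inter_preimage_eq_mul (Set.Iio (M - t + 1))
        (Set.Ici (M + 1)) measurableSet_Iio measurableSet_Ici
      have h4 : μ.real {x | x a ∈ Set.Iio (M - t + 1)} * μ.real {x | x j ∈ Set.Ici (M + 1)} =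
          μ.real ({x | x a ∈ Set.Iio (M - t + 1)} ∩ {x | x j ∈ Set.Ici (M + 1)}) := by
        rw [measureReal_def, measureReal_def, measureReal_def, ← ENNReal.toReal_mul]
        exact (congrArg ENNReal.toReal h3).symm
      rw [hq, ← heval a measurableSet_Iio, ← heval j measurableSet_Ici, h4]
      refine measureReal_mono ?_
      rintro x ⟨hx1, hx2⟩
      have hx1' : x a < M - t + 1 := hx1
      have hx2' : M + 1 ≤ x j := hx2
      change x a + t < x j
      linarith
    rw [e1]
    refine (hZ _ (by linarith)).trans ?_
    rw [mul_assoc, mul_comm q]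
    exact mul_le_mul_of_nonneg_left e2 (by positivity)
  have h2 : μ.real ({x | x a + t < x j} ∩ {x | x c ∈ Set.Ici M}) ≤
      η / 2 * μ.real {x | x a + t < x j} := by
    have h3 := (hind.indepFun_prodMk (fun i => measurable_pi_apply i) a j c hca.symm
      hcj.symm).measure_inter_preimage_eq_mul {p : ℝ × ℝ | p.1 + t < p.2} (Set.Ici M) hmE
        measurableSet_Ici
    have h4 : μ.real ({x | x a + t < x j} ∩ {x | x c ∈ Set.Ici M}) =
        μ.real {x | x a + t < x j} * μ.real {x | x c ∈ Set.Ici M} := by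
      rw [measureReal_def, measureReal_def, measureReal_def, ← ENNReal.toReal_mul]
      exact congrArg ENNReal.toReal h3
    rw [h4, heval c measurableSet_Ici, mul_comm]
    exact mul_le_mul_of_nonneg_right hM measureReal_nonneg
  rw [hE]
  have hsub : {x : Fin m → ℝ | x a + t < x j ∧ x a + t < x c} ⊆
      {x | x a + t < M} ∪ ({x | x a + t < x j} ∩ {x | x c ∈ Set.Ici M}) := by
    rintro x ⟨hx1, hx2⟩
    by_cases hx : x c < M
    · exact Or.inl (hx2.trans hx)
    · exact Or.inr ⟨hx1, not_lt.1 hx⟩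
  have h5 := measureReal_mono (μ := μ) hsub
  have h6 := measureReal_union_le (μ := μ) {x : Fin m → ℝ | x a + t < M}
    ({x | x a + t < x j} ∩ {x | x c ∈ Set.Ici M})
  linarith

end Special

/-! ### Shifting and bounding mean weights -/

section RewardBounds

variable {m : ℕ} (ν : Fin m → Measure ℝ) [∀ i, IsProbabilityMeasure (ν i)]

omit [∀ i, IsProbabilityMeasure (ν i)] in
theorem setOf_belowRel (θ : Fin m → ℝ) (i j : Fin m) :
    {x : Fin m → ℝ | belowRel θ x j i} = {x | x j < x i + (θ i - θ j)} := by
  ext x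
  change x j + θ j < x i + θ i ↔ x j < x i + (θ i - θ j)
  constructor <;> intro h <;> linarith

theorem meanReward_sub_const (g : Fin m → Fin m → ℝ) (c : ℝ) (θ : Fin m → ℝ) (i j : Fin m) :
    meanReward ν (fun k l => g k l - c) θ i j =
      meanReward ν g θ i j - c * pairCdf ν i j (θ i - θ j) := by
  have h : ∀ x, reward (fun k l => g k l - c) i j (belowRel θ x) =
      reward g i j (belowRel θ x) - {x | belowRel θ x j i}.indicator (fun _ => c) x := by
    intro x
    by_cases h : belowRel θ x j i
    · rw [reward_of_rel h, reward_of_rel h, Set.indicator_of_mem (by exact h)]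
    · rw [reward_of_not_rel h, reward_of_not_rel h, Set.indicator_of_notMem (by exact h), sub_zero]
  have hm : MeasurableSet {x | belowRel θ x j i} := by
    rw [setOf_belowRel]
    exact measurableSet_pair_lt i j _
  simp only [meanReward, h]
  rw [integral_sub (integrable_reward ν g θ i j) ((integrable_const c).indicator hm),
    integral_indicator_const _ hm, setOf_belowRel, smul_eq_mul, mul_comm c]
  rfl

/-- Weight is extracted only when `i` beats `j`. The quotients in the stationarity equation hence
stay bounded even as win probabilities degenerate. -/
theorem abs_meanReward_le {g : Fin m → Fin m → ℝ} {C : ℝ} (hC : ∀ k l, |g k l| ≤ C)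
    (θ : Fin m → ℝ) (i j : Fin m) :
    |meanReward ν g θ i j| ≤ C * pairCdf ν i j (θ i - θ j) := by
  have hm : MeasurableSet {x | belowRel θ x j i} := by
    rw [setOf_belowRel]
    exact measurableSet_pair_lt i j _
  have h : ∀ x, |reward g i j (belowRel θ x)| ≤ {x | belowRel θ x j i}.indicator (fun _ => C) x := by
    intro x
    by_cases h : belowRel θ x j i
    · rw [reward_of_rel h, Set.indicator_of_mem (by exact h)]
      exact hC _ _
    · rw [reward_of_not_rel h, Set.indicator_of_notMem (by exact h), abs_zero]
  refine abs_integral_le_integral_abs.trans ?_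
  refine (integral_mono (integrable_reward ν g θ i j).abs ((integrable_const C).indicator hm) h).trans
    (le_of_eq ?_)
  rw [integral_indicator_const _ hm, setOf_belowRel, smul_eq_mul, mul_comm C]
  rfl

variable [∀ i, (ν i).IsOpenPosMeasure]

/-- Subtracting a constant lowers both conditional means by `c`, which cancels in their difference.
-/
theorem StationaryAt.sub_const {φ : Fin m → ℝ → ℝ} {a : Fin m} {g : Fin m → Fin m → ℝ}
    {θ : Fin m → ℝ} (h : StationaryAt ν φ a g θ) (c : ℝ) :
    StationaryAt ν φ a (fun k l => g k l - c) θ := by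
  rw [StationaryAt, ← h]
  refine Finset.sum_congr rfl fun j hj => ?_
  have hja : j ≠ a := Finset.ne_of_mem_erase hj
  rw [meanReward_sub_const, meanReward_sub_const, sub_div, sub_div,
    mul_div_cancel_right₀ _ (pairCdf_pos ν hja.symm _).ne',
    mul_div_cancel_right₀ _ (pairCdf_pos ν hja _).ne']
  ring

end RewardBounds

/-! ### Reflection of the noise -/

section Reflection

variable {m : ℕ} (ν : Fin m → Measure ℝ) [∀ i, IsProbabilityMeasure (ν i)]
  [∀ i, (ν i).IsNegInvariant]

omit [∀ i, IsProbabilityMeasure (ν i)] in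
theorem pairCdf_swap_of_isNegInvariant [∀ i, SigmaFinite (ν i)] (i j : Fin m) (d : ℝ) :
    pairCdf ν j i d = pairCdf ν i j d := by
  rw [pairCdf, pairCdf, measureReal_def, measureReal_def, ← Measure.measure_preimage_neg]
  congr 2
  ext x
  change -x i < -x j + d ↔ x j < x i + d
  constructor <;> intro h <;> linarith

theorem val_place_add_val_place {r : Fin m → Fin m → Prop} {i : Fin m}
    (h : ∀ c, c ≠ i → (r c i ↔ ¬ r i c)) :
    (place (fun i c => r c i) i : ℕ) + place r i + 1 = m := by
  classical
  change (Finset.univ.filter fun c => c ≠ i ∧ r c i).card +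
    (Finset.univ.filter fun c => c ≠ i ∧ r i c).card + 1 = m
  rw [← Finset.card_union_of_disjoint]
  · have : (Finset.univ.filter fun c => c ≠ i ∧ r c i) ∪
        (Finset.univ.filter fun c => c ≠ i ∧ r i c) = Finset.univ.erase i := by
      ext c
      simp only [Finset.mem_union, Finset.mem_filter, Finset.mem_univ, true_and, Finset.mem_erase]
      by_cases hc : c = i
      · simp [hc]
      · simp only [hc, h c hc, ne_eq, not_false_eq_true, true_and, and_true]
        tauto
    rw [this, Finset.card_erase_of_mem (Finset.mem_univ i), Finset.card_univ, Fintype.card_fin]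
    have := i.pos
    omega
  · rw [Finset.disjoint_filter]
    rintro c - ⟨hc, h1⟩ ⟨-, h2⟩
    exact (h c hc).1 h1 h2

variable [∀ i, NullSingletonClass (ν i)]

/-- Negating noise and locations reverses every comparison, so winner and loser swap and places are
counted from the bottom. Ties, where the reversal fails, are null. -/
theorem meanReward_neg (g : Fin m → Fin m → ℝ) (θ : Fin m → ℝ) (i j : Fin m) :
    meanReward ν g (-θ) i j = meanReward ν (fun k l => g l.rev k.rev) θ j i := by
  rw [meanReward, meanReward, ← integral_neg_eq_self]
  refine integral_congr_ae ?_
  filter_upwards [ae_injective_add ν θ] with x hx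
  have hrel : belowRel (-θ) (-x) = fun i c => belowRel θ x c i := by
    funext i c
    refine propext ?_
    simp only [belowRel, Pi.neg_apply]
    constructor <;> intro h <;> linarith
  have htot : ∀ i c, c ≠ i → (belowRel θ x c i ↔ ¬ belowRel θ x i c) := by
    intro i c hc
    simp only [belowRel, not_lt]
    exact ⟨le_of_lt, fun h => lt_of_le_of_ne h fun h' => hc (hx h')⟩
  have hplace : ∀ i, place (fun i c => belowRel θ x c i) i = (place (belowRel θ x) i).rev := by
    intro i
    apply Fin.ext
    have := val_place_add_val_place (htot i)
    rw [Fin.val_rev]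
    omega
  rw [hrel]
  by_cases h : belowRel θ x i j
  · rw [reward_of_rel (r := fun i c => belowRel θ x c i) h, reward_of_rel h, hplace, hplace]
  · rw [reward_of_not_rel (r := fun i c => belowRel θ x c i) h, reward_of_not_rel h]

/-- Reflection exchanges the win and loss terms, turning the sum into its negative. -/
theorem StationaryAt.reflect {φ : Fin m → ℝ → ℝ} {a : Fin m}
    (hφ : ∀ j d, φ j (-d) = φ j d) {g : Fin m → Fin m → ℝ} {θ : Fin m → ℝ}
    (h : StationaryAt ν φ a g (-θ)) :
    StationaryAt ν φ a (fun k l => g l.rev k.rev) θ := by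
  rw [StationaryAt] at h ⊢
  rw [← neg_eq_zero, ← Finset.sum_neg_distrib, ← h]
  refine Finset.sum_congr rfl fun j _ => ?_
  rw [meanReward_neg, meanReward_neg, pairCdf_swap_of_isNegInvariant ν j a,
    pairCdf_swap_of_isNegInvariant ν j a]
  have e1 : (-θ) a - (-θ) j = -(θ a - θ j) := by simp only [Pi.neg_apply]; ring
  have e2 : (-θ) j - (-θ) a = -(θ j - θ a) := by simp only [Pi.neg_apply]; ring
  rw [e1, e2, hφ, neg_sub, neg_sub]
  ring

end Reflection

/-! ### Separated levels and the places within the middle level -/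

section Cluster

variable {m : ℕ}

/-- Alternatives are compared by their level `o` first, and by their utilities within a level. -/
def levelRel (o θ x : Fin m → ℝ) : Fin m → Fin m → Prop :=
  fun i c => o i < o c ∨ o i = o c ∧ belowRel θ x i c

/-- The limiting comparison by levels when `a` is far ahead of its level. -/
def leaderRel (o : Fin m → ℝ) (a : Fin m) (x : Fin m → ℝ) : Fin m → Fin m → Prop :=
  fun i c => o i < o c ∨ o i = o c ∧ i ≠ a ∧ (c = a ∨ x i < x c)

theorem eventually_belowRel_eq_levelRel (o θ x : Fin m → ℝ) :
    ∀ᶠ L : ℝ in atTop, belowRel (fun i => L * o i + θ i) x = levelRel o θ x := by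
  have h : ∀ᶠ L : ℝ in atTop, ∀ i c,
      (belowRel (fun i => L * o i + θ i) x i c ↔ levelRel o θ x i c) := by
    refine eventually_all.2 fun i => eventually_all.2 fun c => ?_
    simp only [belowRel, levelRel]
    rcases lt_trichotomy (o i) (o c) with h | h | h
    · filter_upwards [(tendsto_id.atTop_mul_const (sub_pos.2 h)).eventually_gt_atTop
        (x i + θ i - x c - θ c)] with L hL
      refine iff_of_true ?_ (Or.inl h)
      simp only [id] at hL
      linarith [mul_sub L (o c) (o i)]
    · refine Eventually.of_forall fun L => ?_
      rw [h]
      constructor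
      · intro h'
        exact Or.inr ⟨rfl, by linarith⟩
      · rintro (h' | ⟨-, h'⟩)
        · exact absurd h' (lt_irrefl _)
        · linarith
    · filter_upwards [(tendsto_id.atTop_mul_const (sub_pos.2 h)).eventually_gt_atTop
        (x c + θ c - x i - θ i)] with L hL
      simp only [id] at hL
      refine iff_of_false ?_ ?_
      · linarith [mul_sub L (o i) (o c)]
      · rintro (h' | ⟨h', -⟩) <;> linarith
  filter_upwards [h] with L hL
  funext i c
  exact propext (hL i c)

theorem eventually_levelRel_eq_leaderRel (o : Fin m → ℝ) (a : Fin m) (x : Fin m → ℝ) :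
    ∀ᶠ t : ℝ in atTop, levelRel o (Pi.single a t) x = leaderRel o a x := by
  have h : ∀ᶠ t : ℝ in atTop, ∀ i c,
      (belowRel (Pi.single a t) x i c ↔ i ≠ a ∧ (c = a ∨ x i < x c)) := by
    refine eventually_all.2 fun i => eventually_all.2 fun c => ?_
    filter_upwards [eventually_gt_atTop (x i - x c), eventually_ge_atTop (x c - x i)] with t h1 h2
    simp only [belowRel]
    by_cases hi : i = a
    · subst hi
      by_cases hc : c = i
      · subst hc
        simp
      · simp only [Pi.single_eq_same, Pi.single_eq_of_ne hc, ne_eq, not_true_eq_false, false_and,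
          iff_false, not_lt]
        linarith
    · by_cases hc : c = a
      · subst hc
        simp only [Pi.single_eq_same, Pi.single_eq_of_ne hi, ne_eq, hi, not_false_eq_true, true_or,
          and_self, iff_true]
        linarith
      · simp [hi, hc]
  filter_upwards [h] with t ht
  funext i c
  simp only [levelRel, leaderRel, ht]

theorem measurable_levelRel (o θ : Fin m → ℝ) : Measurable (levelRel o θ) := by
  have h : levelRel o θ = (fun r : Fin m → Fin m → Prop => fun i c =>
      o i < o c ∨ o i = o c ∧ r i c) ∘ belowRel θ := rfl
  rw [h]
  exact Measurable.of_discrete.comp (measurable_belowRel θ)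

theorem measurable_leaderRel (o : Fin m → ℝ) (a : Fin m) : Measurable (leaderRel o a) := by
  have h : leaderRel o a = (fun r : Fin m → Fin m → Prop => fun i c =>
      o i < o c ∨ o i = o c ∧ i ≠ a ∧ (c = a ∨ r i c)) ∘ belowRel 0 := by
    funext x i c
    simp [leaderRel, belowRel]
  rw [h]
  exact Measurable.of_discrete.comp (measurable_belowRel 0)

theorem card_filter_swap (a k : Fin m) (p : Fin m → Prop) [DecidablePred p] :
    (Finset.univ.filter fun i => p (Equiv.swap a k i)).card = (Finset.univ.filter p).card :=
  Finset.card_equiv (Equiv.swap a k) (by simp)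

/-- The level of an alternative: after swapping `a` with `k`, the alternatives before `k` form the
top level `1`, those after `l` the bottom level `-1`, and those from `k` to `l`, among them `a`, the
middle level `0`. -/
def levelOf (a k l i : Fin m) : ℝ :=
  if Equiv.swap a k i < k then 1 else if l < Equiv.swap a k i then -1 else 0

theorem levelOf_pos_iff {a k l : Fin m} (i : Fin m) :
    0 < levelOf a k l i ↔ Equiv.swap a k i < k := by
  rw [levelOf]
  split_ifs with h1 h2
  · exact iff_of_true one_pos h1
  · exact iff_of_false (by norm_num) h1
  · exact iff_of_false (lt_irrefl _) h1

theorem levelOf_nonneg_iff {a k l : Fin m} (hkl : k < l) (i : Fin m) :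
    0 ≤ levelOf a k l i ↔ Equiv.swap a k i ≤ l := by
  rw [levelOf]
  split_ifs with h1 h2
  · exact iff_of_true zero_le_one (h1.le.trans hkl.le)
  · exact iff_of_false (by norm_num) (not_le.2 h2)
  · exact iff_of_true le_rfl (not_lt.1 h2)

theorem levelOf_self {a k l : Fin m} (hkl : k < l) : levelOf a k l a = 0 := by
  rw [levelOf, Equiv.swap_apply_left, if_neg (lt_irrefl k), if_neg (not_lt.2 hkl.le)]

theorem card_levelOf_pos (a k l : Fin m) :
    (Finset.univ.filter fun i => 0 < levelOf a k l i).card = k := by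
  simp only [levelOf_pos_iff]
  rw [card_filter_swap a k (fun i => i < k), ← Fin.card_Iio k]
  congr 1
  ext i
  simp

theorem card_levelOf_nonneg {a k l : Fin m} (hkl : k < l) :
    (Finset.univ.filter fun i => 0 ≤ levelOf a k l i).card = l + 1 := by
  simp only [levelOf_nonneg_iff hkl]
  rw [card_filter_swap a k (fun i => i ≤ l), ← Fin.card_Iic l]
  congr 1
  ext i
  simp

open Classical in
theorem val_place (r : Fin m → Fin m → Prop) (i : Fin m) :
    (place r i : ℕ) = (Finset.univ.filter fun c => c ≠ i ∧ r i c).card := rfl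

section Places

variable {a k l j : Fin m} (hkl : k < l) (hja : j ≠ a) (hj : levelOf a k l j = 0)

include hkl in
theorem place_leaderRel_self (x : Fin m → ℝ) : place (leaderRel (levelOf a k l) a x) a = k := by
  classical
  apply Fin.ext
  rw [val_place, ← card_levelOf_pos a k l]
  congr 1
  ext c
  simp only [Finset.mem_filter, Finset.mem_univ, true_and, leaderRel, levelOf_self hkl, ne_eq,
    not_true_eq_false, false_and, and_false, or_false]
  refine and_iff_right_of_imp fun h h' => ?_
  rw [h', levelOf_self hkl] at h
  exact lt_irrefl _ h

include hkl hja hj in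
-- Above `j` are the `k` alternatives of the top level and also `a`.
theorem lt_place_leaderRel (x : Fin m → ℝ) : k < place (leaderRel (levelOf a k l) a x) j := by
  classical
  rw [Fin.lt_def, val_place, ← card_levelOf_pos a k l]
  refine Finset.card_lt_card (Finset.ssubset_iff_of_subset ?_ |>.2 ⟨a, ?_, ?_⟩)
  · intro c hc
    rw [Finset.mem_filter] at hc
    rw [Finset.mem_filter]
    refine ⟨Finset.mem_univ _, ?_, Or.inl (by rw [hj]; exact hc.2)⟩
    rintro rfl
    exact absurd hc.2 (by rw [hj]; exact lt_irrefl _)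
  · rw [Finset.mem_filter]
    exact ⟨Finset.mem_univ _, hja.symm,
      Or.inr ⟨by rw [hj, levelOf_self hkl], hja, Or.inl rfl⟩⟩
  · rw [Finset.mem_filter, levelOf_self hkl]
    exact fun h => lt_irrefl _ h.2

include hkl hj in
-- Everything above `j` has nonnegative level, as does `j` itself, and only `l + 1` alternatives do.
theorem place_leaderRel_le (x : Fin m → ℝ) : place (leaderRel (levelOf a k l) a x) j ≤ l := by
  classical
  rw [Fin.le_def, val_place, ← Nat.lt_succ_iff, Nat.succ_eq_add_one, ← card_levelOf_nonneg hkl (a := a)]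
  refine Finset.card_lt_card (Finset.ssubset_iff_of_subset ?_ |>.2 ⟨j, ?_, ?_⟩)
  · intro c hc
    rw [Finset.mem_filter] at hc
    rw [Finset.mem_filter]
    refine ⟨Finset.mem_univ _, ?_⟩
    rcases hc.2.2 with h | ⟨h, -⟩
    · rw [hj] at h
      exact h.le
    · rw [hj] at h
      exact h.le
  · rw [Finset.mem_filter]
    exact ⟨Finset.mem_univ _, hj.ge⟩
  · rw [Finset.mem_filter]
    exact fun h => h.2.1 rfl

include hkl hja hj in
theorem place_leaderRel_eq {x : Fin m → ℝ} (hx : ∀ c, c ≠ j → x j < x c) :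
    place (leaderRel (levelOf a k l) a x) j = l := by
  classical
  apply Fin.ext
  have h : (Finset.univ.filter fun c => c ≠ j ∧ leaderRel (levelOf a k l) a x j c) =
      (Finset.univ.filter fun c => 0 ≤ levelOf a k l c).erase j := by
    ext c
    simp only [Finset.mem_filter, Finset.mem_univ, true_and, Finset.mem_erase]
    refine and_congr_right fun hc => ?_
    simp only [leaderRel, hj]
    constructor
    · rintro (h | ⟨h, -⟩)
      · exact h.le
      · exact h.le
    · intro h
      rcases h.lt_or_eq with h | h
      · exact Or.inl h
      · exact Or.inr ⟨h, hja, Or.inr (hx c hc)⟩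
  rw [val_place, h, Finset.card_erase_of_mem, card_levelOf_nonneg hkl, Nat.add_sub_cancel]
  rw [Finset.mem_filter]
  exact ⟨Finset.mem_univ _, hj.ge⟩

include hkl hja hj in
/-- If `a` loses to `j` but to no other alternative of its level, then `j` and `a` take the first
two places of the level. -/
theorem places_of_lose_once {t : ℝ} {x : Fin m → ℝ} (hx : x a + t < x j)
    (hc : ∀ c, c ≠ a → c ≠ j → ¬ x a + t < x c) :
    place (levelRel (levelOf a k l) (Pi.single a t) x) j = k ∧
      (place (levelRel (levelOf a k l) (Pi.single a t) x) a : ℕ) = k + 1 := by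
  classical
  have hrel : ∀ i c, belowRel (Pi.single a t) x i c ↔
      x i + Pi.single (M := fun _ => ℝ) a t i < x c + Pi.single (M := fun _ => ℝ) a t c :=
    fun i c => Iff.rfl
  constructor
  · apply Fin.ext
    rw [val_place, ← card_levelOf_pos a k l]
    congr 1
    ext c
    simp only [Finset.mem_filter, Finset.mem_univ, true_and, levelRel, hj]
    constructor
    · rintro ⟨hcj, h | ⟨-, h⟩⟩
      · exact h
      · exfalso
        rw [hrel, Pi.single_eq_of_ne hja] at h
        by_cases hca : c = a
        · rw [hca, Pi.single_eq_same] at h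
          linarith
        · rw [Pi.single_eq_of_ne hca] at h
          have := hc c hca hcj
          linarith
    · intro h
      refine ⟨?_, Or.inl h⟩
      rintro rfl
      rw [hj] at h
      exact lt_irrefl _ h
  · have h : (Finset.univ.filter fun c => c ≠ a ∧
        levelRel (levelOf a k l) (Pi.single a t) x a c) =
        insert j (Finset.univ.filter fun c => 0 < levelOf a k l c) := by
      ext c
      simp only [Finset.mem_filter, Finset.mem_univ, true_and, levelRel, levelOf_self hkl,
        Finset.mem_insert]
      constructor
      · rintro ⟨hca, h | ⟨-, h⟩⟩
        · exact Or.inr h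
        · rw [hrel, Pi.single_eq_same, Pi.single_eq_of_ne hca, add_zero] at h
          by_contra hn
          exact hc c hca (fun h => hn (Or.inl h)) h
      · rintro (rfl | h)
        · refine ⟨hja, Or.inr ⟨hj.symm, ?_⟩⟩
          rw [hrel, Pi.single_eq_same, Pi.single_eq_of_ne hja, add_zero]
          exact hx
        · refine ⟨?_, Or.inl h⟩
          rintro rfl
          rw [levelOf_self hkl] at h
          exact lt_irrefl _ h
    rw [val_place, h, Finset.card_insert_of_notMem, card_levelOf_pos]
    rw [Finset.mem_filter, hj]
    exact fun h => lt_irrefl _ h.2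

end Places

end Cluster

/-! ### Limits of the stationarity equation -/

section Limits

variable {m : ℕ} {π : Fin m → ℝ → ℝ} (hπ : ∀ i, IsUtilityDensity (π i)) {a : Fin m}
  (ha : IsLightTailed (π a)) {g : Fin m → Fin m → ℝ}

/-- The expected weight extracted for "`i` above `j`" when alternatives are compared by their level
first. -/
def levelReward (ν : Fin m → Measure ℝ) (g : Fin m → Fin m → ℝ) (o θ : Fin m → ℝ) (i j : Fin m) :
    ℝ :=
  ∫ x, reward g i j (levelRel o θ x) ∂Measure.pi ν

theorem tendsto_meanReward_levelReward (ν : Fin m → Measure ℝ) [∀ i, IsProbabilityMeasure (ν i)]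
    (g : Fin m → Fin m → ℝ) (o θ : Fin m → ℝ) (i j : Fin m) :
    Tendsto (fun L : ℝ => meanReward ν g (fun i => L * o i + θ i) i j) atTop
      (𝓝 (levelReward ν g o θ i j)) :=
  tendsto_integral_comp_of_eventually_eq (fun _ => measurable_belowRel _) (reward g i j)
    (Eventually.of_forall fun x => eventually_belowRel_eq_levelRel o θ x)

include hπ ha in
/-- Moving the other levels to infinity, the stationarity equation localizes to the level of `a`. -/
theorem sum_level_eq_zero
    (hst : ∀ θ, StationaryAt (fun i => shapeLaw (π i)) (diffDensity π a) a g θ)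
    {o : Fin m → ℝ} (hoa : o a = 0) (t : ℝ) :
    ∑ j ∈ Finset.univ.erase a, (if o j = 0 then diffDensity π a j t *
      (levelReward (fun i => shapeLaw (π i)) g o (Pi.single a t) a j /
          pairCdf (fun i => shapeLaw (π i)) a j t -
        levelReward (fun i => shapeLaw (π i)) g o (Pi.single a t) j a /
          pairCdf (fun i => shapeLaw (π i)) j a (-t)) else 0) = 0 := by
  have : ∀ i, IsProbabilityMeasure (shapeLaw (π i)) := fun i => (hπ i).isProbabilityMeasure
  have : ∀ i, (shapeLaw (π i)).IsOpenPosMeasure := fun i => (hπ i).isOpenPosMeasure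
  set ν : Fin m → Measure ℝ := fun i => shapeLaw (π i) with hν
  set θ : ℝ → Fin m → ℝ := fun L i => L * o i + Pi.single (M := fun _ => ℝ) a t i with hθ
  obtain ⟨C, hC0, hC⟩ := exists_abs_le_of_finite fun q : Fin m × Fin m => g q.1 q.2
  have hratio : ∀ (θ : Fin m → ℝ) (i j : Fin m), i ≠ j →
      |meanReward ν g θ i j / pairCdf ν i j (θ i - θ j)| ≤ C := by
    intro θ i j hij
    rw [abs_div, abs_of_pos (pairCdf_pos ν hij _), div_le_iff₀ (pairCdf_pos ν hij _)]
    exact abs_meanReward_le ν (fun k l => hC (k, l)) θ i j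
  have hlim : Tendsto (fun L => ∑ j ∈ Finset.univ.erase a, diffDensity π a j (θ L a - θ L j) *
      (meanReward ν g (θ L) a j / pairCdf ν a j (θ L a - θ L j) -
        meanReward ν g (θ L) j a / pairCdf ν j a (θ L j - θ L a))) atTop
      (𝓝 (∑ j ∈ Finset.univ.erase a, (if o j = 0 then diffDensity π a j t *
        (levelReward ν g o (Pi.single a t) a j / pairCdf ν a j t -
          levelReward ν g o (Pi.single a t) j a / pairCdf ν j a (-t)) else 0))) := by
    refine tendsto_finsetSum _ fun j hj => ?_
    have hja : j ≠ a := Finset.ne_of_mem_erase hj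
    have hdiff : ∀ L, θ L a - θ L j = t - L * o j := fun L => by
      simp only [hθ, hoa, Pi.single_eq_same, Pi.single_eq_of_ne hja]
      ring
    by_cases hoj : o j = 0
    · rw [if_pos hoj]
      have h1 : ∀ L, θ L a - θ L j = t := fun L => by rw [hdiff, hoj]; ring
      have h2 : ∀ L, θ L j - θ L a = -t := fun L => by rw [← h1 L]; ring
      simp only [h1, h2]
      exact ((((tendsto_meanReward_levelReward ν g o (Pi.single a t) a j).div_const _).sub
        ((tendsto_meanReward_levelReward ν g o (Pi.single a t) j a).div_const _)).const_mul _)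
    · rw [if_neg hoj]
      -- At another level the density factor vanishes in the limit, while the quotients remain
      -- bounded by `C`.
      have h1 : Tendsto (fun L => diffDensity π a j (θ L a - θ L j)) atTop (𝓝 0) := by
        simp only [hdiff]
        rcases lt_or_gt_of_ne hoj with h | h
        · refine (tendsto_diffDensity_atTop hπ ha).comp
            (tendsto_atTop_add_const_left _ t (tendsto_neg_atBot_atTop.comp ?_))
          exact tendsto_id.atTop_mul_const_of_neg h
        · refine (tendsto_diffDensity_atBot hπ ha).comp
            (tendsto_atBot_add_const_left _ t (tendsto_neg_atTop_atBot.comp ?_))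
          exact tendsto_id.atTop_mul_const h
      refine squeeze_zero_norm (a := fun L => |diffDensity π a j (θ L a - θ L j)| * (C + C))
        (fun L => ?_) (by simpa using h1.abs.mul_const (C + C))
      rw [Real.norm_eq_abs, abs_mul]
      refine mul_le_mul_of_nonneg_left ((abs_sub _ _).trans ?_) (abs_nonneg _)
      exact add_le_add (hratio _ _ _ hja.symm) (hratio _ _ _ hja)
  refine tendsto_nhds_unique hlim ?_
  simp only [show ∀ L, _ = (0 : ℝ) from fun L => hst (θ L)]
  exact tendsto_const_nhds

variable {k l j : Fin m} (hkl : k < l) (hg : ∀ x, k < x → x < l → g k x = 0)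
  (hja : j ≠ a) (hj : levelOf a k l j = 0)

include hπ hkl hg hja hj in
-- In the limit `a` is at `k` and `j` strictly after `k` and at most at `l`. By `hg` only place `l`
-- carries weight, and `q` is the probability that `j` is there.
theorem tendsto_levelReward_win : ∃ q, 0 < q ∧
    Tendsto (fun t : ℝ => levelReward (fun i => shapeLaw (π i)) g (levelOf a k l) (Pi.single a t) a j /
      pairCdf (fun i => shapeLaw (π i)) a j t) atTop (𝓝 (g k l * q)) := by
  have : ∀ i, IsProbabilityMeasure (shapeLaw (π i)) := fun i => (hπ i).isProbabilityMeasure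
  have : ∀ i, (shapeLaw (π i)).IsOpenPosMeasure := fun i => (hπ i).isOpenPosMeasure
  set ν : Fin m → Measure ℝ := fun i => shapeLaw (π i) with hν
  set B : Set (Fin m → ℝ) := {x | place (leaderRel (levelOf a k l) a x) j = l} with hB
  have hlim := tendsto_integral_comp_of_eventually_eq (μ := Measure.pi ν) (L := atTop)
    (fun t : ℝ => measurable_levelRel (levelOf a k l) (Pi.single a t)) (reward g a j)
    (Eventually.of_forall fun x => eventually_levelRel_eq_leaderRel (levelOf a k l) a x)
  have hrew : ∀ x, reward g a j (leaderRel (levelOf a k l) a x) =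
      B.indicator (fun _ => g k l) x := by
    intro x
    rw [reward_of_rel (Or.inr ⟨by rw [hj, levelOf_self hkl], hja, Or.inl rfl⟩),
      place_leaderRel_self hkl]
    by_cases hx : x ∈ B
    · rw [Set.indicator_of_mem hx, show place (leaderRel (levelOf a k l) a x) j = l from hx]
    · rw [Set.indicator_of_notMem hx]
      exact hg _ (lt_place_leaderRel hkl hja hj x) (lt_of_le_of_ne (place_leaderRel_le hkl hj x) hx)
  have hBm : MeasurableSet B := measurable_leaderRel (levelOf a k l) a
    (MeasurableSet.of_discrete (s := {r | place r j = l}))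
  refine ⟨(Measure.pi ν).real B, ?_, ?_⟩
  · have ho : IsOpen {x : Fin m → ℝ | ∀ c, c ≠ j → x j < x c} := by
      simp only [Set.ofPred_forall]
      exact isOpen_iInter_of_finite fun c => isOpen_iInter_of_finite fun _ =>
        isOpen_lt (by fun_prop) (by fun_prop)
    have hne : {x : Fin m → ℝ | ∀ c, c ≠ j → x j < x c}.Nonempty :=
      ⟨Pi.single j (-1), fun c hc => by simp [hc]⟩
    refine lt_of_lt_of_le (ENNReal.toReal_pos (ho.measure_ne_zero (Measure.pi ν) hne)
      (measure_ne_top _ _)) ?_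
    exact measureReal_mono fun x hx => place_leaderRel_eq hkl hja hj hx
  · have h1 := hlim.div (tendsto_pairCdf_atTop ν a j) one_ne_zero
    simp only [hrew] at h1
    rw [integral_indicator_const _ hBm, div_one, smul_eq_mul, mul_comm] at h1
    exact h1

include hπ ha hkl hg hja hj in
-- If `a` loses to `j` alone, the places are `k` and `k + 1 < l`, and `hg` makes the weight zero.
-- Losing to a further alternative is negligible relative to losing to `j`.
theorem tendsto_levelReward_lose (hkl' : (k : ℕ) + 1 < l) :
    Tendsto (fun t : ℝ => levelReward (fun i => shapeLaw (π i)) g (levelOf a k l) (Pi.single a t) j a /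
      pairCdf (fun i => shapeLaw (π i)) j a (-t)) atTop (𝓝 0) := by
  have : ∀ i, IsProbabilityMeasure (shapeLaw (π i)) := fun i => (hπ i).isProbabilityMeasure
  have : ∀ i, (shapeLaw (π i)).IsOpenPosMeasure := fun i => (hπ i).isOpenPosMeasure
  set ν : Fin m → Measure ℝ := fun i => shapeLaw (π i) with hν
  obtain ⟨C, hC0, hC⟩ := exists_abs_le_of_finite fun q : Fin m × Fin m => g q.1 q.2
  -- All levels are included: an upper bound suffices, so counting irrelevant alternatives is
  -- harmless.
  set T : Finset (Fin m) := (Finset.univ.erase a).erase j with hT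
  set E : ℝ → Fin m → Set (Fin m → ℝ) := fun t c => {x | x a + t < x j ∧ x a + t < x c} with hE
  have hEm : ∀ t c, MeasurableSet (E t c) := fun t c =>
    (measurableSet_lt (by fun_prop) (by fun_prop) : MeasurableSet {x : Fin m → ℝ | x a + t < x j}).inter
      (measurableSet_lt (by fun_prop) (by fun_prop) : MeasurableSet {x : Fin m → ℝ | x a + t < x c})
  have hpt : ∀ t x, |reward g j a (levelRel (levelOf a k l) (Pi.single a t) x)| ≤
      ∑ c ∈ T, (E t c).indicator (fun _ => C) x := by
    intro t x
    have hnn : ∀ c ∈ T, 0 ≤ (E t c).indicator (fun _ => C) x :=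
      fun c _ => Set.indicator_nonneg (fun _ _ => hC0) _
    by_cases hr : levelRel (levelOf a k l) (Pi.single a t) x a j
    · have hx : x a + t < x j := by
        rcases hr with h | ⟨-, h⟩
        · rw [hj, levelOf_self hkl] at h
          exact absurd h (lt_irrefl _)
        · simpa [belowRel, Pi.single_eq_of_ne hja] using h
      by_cases hex : ∃ c ∈ T, x a + t < x c
      · obtain ⟨c, hcT, hc⟩ := hex
        refine le_trans ?_ (Finset.single_le_sum hnn hcT)
        rw [Set.indicator_of_mem (show x ∈ E t c from ⟨hx, hc⟩), reward_of_rel hr]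
        exact hC (_, _)
      · push Not at hex
        obtain ⟨h1, h2⟩ := places_of_lose_once hkl hja hj hx fun c hca hcj =>
          not_lt.2 (hex c (by simp [hT, hca, hcj]))
        rw [reward_of_rel hr, h1, hg _ (Fin.lt_def.2 (by omega)) (Fin.lt_def.2 (by omega)),
          abs_zero]
        exact Finset.sum_nonneg hnn
    · rw [reward_of_not_rel hr, abs_zero]
      exact Finset.sum_nonneg hnn
  have hint : ∀ t, |levelReward ν g (levelOf a k l) (Pi.single a t) j a| ≤
      C * ∑ c ∈ T, (Measure.pi ν).real (E t c) := by
    intro t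
    have hi : ∀ c ∈ T, Integrable ((E t c).indicator fun _ => C) (Measure.pi ν) :=
      fun c _ => (integrable_const C).indicator (hEm t c)
    refine abs_integral_le_integral_abs.trans ((integral_mono
      (integrable_comp_of_finite (measurable_levelRel _ _) (reward g j a)).abs
      (integrable_finsetSum _ hi) (hpt t)).trans (le_of_eq ?_))
    rw [integral_finsetSum _ hi, Finset.mul_sum]
    refine Finset.sum_congr rfl fun c _ => ?_
    rw [integral_indicator_const _ (hEm t c), smul_eq_mul, mul_comm]
  refine Metric.tendsto_nhds.2 fun ε hε => ?_
  set η : ℝ := ε / (2 * (C * T.card + 1)) with hη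
  have hden : 0 < C * T.card + 1 := by positivity
  have hη0 : 0 < η := by positivity
  have hev : ∀ᶠ t in atTop, ∀ c ∈ T, (Measure.pi ν).real (E t c) ≤ η * pairCdf ν j a (-t) :=
    (Finset.eventually_all _).2 fun c hc => exists_lose_both_le hπ ha hja
      (Finset.ne_of_mem_erase (Finset.mem_of_mem_erase hc)) (Finset.ne_of_mem_erase hc) hη0
  filter_upwards [hev] with t ht
  have hp := pairCdf_pos ν hja (-t)
  rw [dist_zero_right, Real.norm_eq_abs, abs_div, abs_of_pos hp, div_lt_iff₀ hp]
  refine (hint t).trans_lt ?_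
  have h1 : ∑ c ∈ T, (Measure.pi ν).real (E t c) ≤ T.card * (η * pairCdf ν j a (-t)) := by
    rw [← nsmul_eq_mul]
    exact Finset.sum_le_card_nsmul _ _ _ ht
  have h2 : C * ↑T.card * η < ε := by
    have : (C * T.card + 1) * η = ε / 2 := by
      rw [hη]
      field_simp
    nlinarith
  calc C * ∑ c ∈ T, (Measure.pi ν).real (E t c)
      ≤ C * (T.card * (η * pairCdf ν j a (-t))) := mul_le_mul_of_nonneg_left h1 hC0
    _ = (C * T.card * η) * pairCdf ν j a (-t) := by ring
    _ < ε * pairCdf ν j a (-t) := mul_lt_mul_of_pos_right h2 hp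

end Limits

/-! ### From stationarity to uniform weights -/

section Main

variable {m : ℕ} {π : Fin m → ℝ → ℝ} (hπ : ∀ i, IsUtilityDensity (π i)) {a : Fin m}
  (ha : IsLightTailed (π a)) {g : Fin m → Fin m → ℝ}

include hπ ha in
theorem eq_zero_of_forall_between_eq_zero
    (hst : ∀ θ, StationaryAt (fun i => shapeLaw (π i)) (diffDensity π a) a g θ)
    {k l : Fin m} (hkl : (k : ℕ) + 1 < l) (hg : ∀ x, k < x → x < l → g k x = 0) : g k l = 0 := by
  have hlt : k < l := Fin.lt_def.2 (by omega)
  by_contra hne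
  -- Multiplying by `g k l` makes the limit of each bracket `q * (g k l) ^ 2 > 0`, whatever the sign
  -- of `g k l`.
  have hbr : ∀ j ∈ Finset.univ.erase a, ∀ᶠ t : ℝ in atTop, levelOf a k l j = 0 →
      0 < (levelReward (fun i => shapeLaw (π i)) g (levelOf a k l) (Pi.single a t) a j /
          pairCdf (fun i => shapeLaw (π i)) a j t -
        levelReward (fun i => shapeLaw (π i)) g (levelOf a k l) (Pi.single a t) j a /
          pairCdf (fun i => shapeLaw (π i)) j a (-t)) * g k l := by
    intro j hj
    have hja : j ≠ a := Finset.ne_of_mem_erase hj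
    by_cases ho : levelOf a k l j = 0
    · obtain ⟨q, hq, hlim⟩ := tendsto_levelReward_win hπ hlt hg hja ho
      have h := (hlim.sub (tendsto_levelReward_lose hπ ha hlt hg hja ho hkl)).mul_const (g k l)
      have hpos : 0 < (g k l * q - 0) * g k l := by
        have : (g k l * q - 0) * g k l = q * (g k l) ^ 2 := by ring
        rw [this]
        positivity
      filter_upwards [h.eventually_const_lt hpos] with t ht _
      exact ht
    · exact Eventually.of_forall fun t h => absurd h ho
  obtain ⟨t, ht⟩ := ((Finset.eventually_all _).2 hbr).exists
  have h0 := congrArg (· * g k l) (sum_level_eq_zero hπ ha hst (levelOf_self (a := a) hlt) t)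
  simp only [zero_mul, Finset.sum_mul] at h0
  -- The alternative `Equiv.swap a k l` shares the level of `a`, so at least one term of the sum is
  -- strictly positive.
  have hal : Equiv.swap a k l ≠ a := by
    intro h
    have h' := congrArg (Equiv.swap a k) h
    rw [Equiv.swap_apply_self, Equiv.swap_apply_left] at h'
    exact hlt.ne' h'
  have hol : levelOf a k l (Equiv.swap a k l) = 0 := by
    rw [levelOf, Equiv.swap_apply_self, if_neg (not_lt.2 hlt.le), if_neg (lt_irrefl l)]
  refine absurd h0 (ne_of_gt (Finset.sum_pos' (fun j hj => ?_)
    ⟨Equiv.swap a k l, Finset.mem_erase.2 ⟨hal, Finset.mem_univ _⟩, ?_⟩))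
  · split_ifs with ho
    · rw [mul_assoc]
      exact mul_nonneg (diffDensity_pos hπ ha t).le (ht j hj ho).le
    · rw [zero_mul]
  · rw [if_pos hol, mul_assoc]
    exact mul_pos (diffDensity_pos hπ ha t)
      (ht _ (Finset.mem_erase.2 ⟨hal, Finset.mem_univ _⟩) hol)

include hπ ha in
-- Strong induction on `l`: after subtracting `g k k'`, the weights strictly between vanish.
theorem weight_eq_weight_succ
    (hst : ∀ θ, StationaryAt (fun i => shapeLaw (π i)) (diffDensity π a) a g θ)
    {k k' l : Fin m} (hk : (k' : ℕ) = k + 1) (hkl : k < l) : g k l = g k k' := by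
  have : ∀ i, IsProbabilityMeasure (shapeLaw (π i)) := fun i => (hπ i).isProbabilityMeasure
  have : ∀ i, (shapeLaw (π i)).IsOpenPosMeasure := fun i => (hπ i).isOpenPosMeasure
  induction l using WellFoundedLT.induction with
  | _ l ih =>
    rcases (show (k : ℕ) + 1 ≤ l from hkl).lt_or_eq with h | h
    · have := eq_zero_of_forall_between_eq_zero (g := fun x y => g x y - g k k') hπ ha
        (fun θ => (hst θ).sub_const _ (g k k')) h fun x hx hxl => sub_eq_zero.2 (ih x hxl hx)
      exact sub_eq_zero.1 this
    · rw [show l = k' from Fin.ext (by omega)]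

theorem diffDensity_neg (hs : ∀ i x, π i (-x) = π i x) (a j : Fin m) (d : ℝ) :
    diffDensity π a j (-d) = diffDensity π a j d := by
  have := isNegInvariant_shapeLaw (hs j)
  rw [diffDensity, diffDensity, ← integral_neg_eq_self]
  refine integral_congr_ae (Eventually.of_forall fun y => ?_)
  change π a (-y - -d) = π a (y - d)
  rw [← hs a (y - d)]
  congr 1
  ring

include hπ ha in
theorem isUniform_of_stationary (hs : ∀ i x, π i (-x) = π i x) {G : Breaking m}
    (hst : ∀ θ, StationaryAt (fun i => shapeLaw (π i)) (diffDensity π a) a G.weight θ) :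
    G.IsUniform := by
  have : ∀ i, IsProbabilityMeasure (shapeLaw (π i)) := fun i => (hπ i).isProbabilityMeasure
  have : ∀ i, NullSingletonClass (shapeLaw (π i)) := fun i => nullSingletonClass_shapeLaw _
  have : ∀ i, (shapeLaw (π i)).IsNegInvariant := fun i => isNegInvariant_shapeLaw (hs i)
  have hst' : ∀ θ, StationaryAt (fun i => shapeLaw (π i)) (diffDensity π a) a
      (fun k l => G.weight l.rev k.rev) θ := fun θ =>
    StationaryAt.reflect _ (diffDensity_neg hs a) (hst (-θ))
  have hpred : ∀ {k l l' : Fin m}, (l : ℕ) = l' + 1 → k < l → G.weight k l = G.weight l' l := by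
    intro k l l' hl hkl
    have h := weight_eq_weight_succ hπ ha hst' (k := l.rev) (k' := l'.rev) (l := k.rev)
      (by rw [Fin.val_rev, Fin.val_rev]; omega) (Fin.rev_lt_rev.2 hkl)
    simpa using h
  rcases Nat.lt_or_ge m 2 with hm | hm
  · refine ⟨0, fun k l hkl => absurd (Fin.ext ?_) hkl⟩
    omega
  · refine ⟨G.weight ⟨0, by omega⟩ ⟨1, by omega⟩, ?_⟩
    have hlt : ∀ k l, k < l → G.weight k l = G.weight ⟨0, by omega⟩ ⟨1, by omega⟩ := by
      intro k l hkl
      have h0 : (⟨0, by omega⟩ : Fin m) < l := Fin.lt_def.2 (by simp only; omega)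
      -- The chain of equal weights is `(k, l)`, `(l - 1, l)`, `(0, l)`, `(0, 1)`.
      rw [← weight_eq_weight_succ hπ ha hst (k := ⟨0, by omega⟩) (k' := ⟨1, by omega⟩) rfl h0,
        hpred (l' := ⟨l - 1, by omega⟩) (by simp only; omega) hkl,
        hpred (l' := ⟨l - 1, by omega⟩) (by simp only; omega) h0]
    intro k l hkl
    rcases lt_or_gt_of_ne hkl with h | h
    · exact hlt k l h
    · rw [G.symm]
      exact hlt l k h

end Main

end

theorem mainTheorem6 (m : ℕ) (π : Fin m → ℝ → ℝ)
    (hπ : ∀ i, IsUtilityDensity (π i))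
    (hsymm : ∀ i x, π i (-x) = π i x)
    (hspecial : ∃ i, Differentiable ℝ (π i) ∧
      Antitone (deriv fun x => Real.log (π i x)) ∧
      Tendsto (deriv fun x => Real.log (π i x)) atBot atTop)
    (G : Breaking m) (hG : G.IsNonempty)
    (W : CMLWeight m) (hW : W.IsUniform) :
    RBCMLConsistent π G W ↔ G.IsUniform := by
  refine ⟨fun hcons => ?_, fun hu => rbcmlConsistent_of_isUniform hπ hG hu hW⟩
  obtain ⟨a, hdiff, hanti, htend⟩ := hspecial
  obtain ⟨w, hw, hWw⟩ := hW
  have ha : IsLightTailed (π a) := ⟨hπ a, hsymm a, hdiff, hanti, htend⟩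
  have : ∀ i, IsProbabilityMeasure (shapeLaw (π i)) := fun i => (hπ i).isProbabilityMeasure
  have : ∀ i, (shapeLaw (π i)).IsOpenPosMeasure := fun i => (hπ i).isOpenPosMeasure
  have : ∀ i, NullSingletonClass (shapeLaw (π i)) := fun i => nullSingletonClass_shapeLaw _
  exact isUniform_of_stationary hπ ha hsymm fun θ =>
    stationaryAt_of_isMax _ (fun j hj => hasDerivAt_pairCdf hπ ha hj) hw
      (hcons.compLik_le hπ hWw θ)
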